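/- Consider a piston of mass $M$ moving on the line $\mathbb R$ in an ideal gas of atoms of mass $m$, and put $\varepsilon=m/M$. Fix $0<v_{\min}<v_{\max}<\infty$, spatial densities $n_-,n_+>0$, and even probability densities $f_-,f_+$ on $\mathbb R$ that vanish at all $v$ with $|v|\le v_{\min}$ or $|v|\ge v_{\max}$ and satisfy the pressure balance $$n_-\int_0^\infty v^2f_-(v)\,dv=n_+\int_0^\infty v^2f_+(v)\,dv .$$ The initial positions and velocities $(x,v)$ of the atoms form a Poisson process on $\mathbb R^2$ with density $p(x,v)=n_+f_+(v)$ for $x>0$ and $p(x,v)=n_-f_-(v)$ for $x<0$. The piston starts at the origin with velocity $V(0)$, where $|V(0)|<\varepsilon^{1/2}$. The atoms do not interact with each other; between collisions with the piston, the atoms and the piston move with constant velocities, and when an atom of velocity $v$ meets the piston of velocity $V$, their velocities change to $$V'=\frac{M-m}{M+m}V+\frac{2m}{M+m}v,\qquad v'=-\frac{M-m}{M+m}v+\frac{2M}{M+m}V .$$ Let $V(t)$ be the velocity of the piston in this dynamics. For a cutoff value $\bar V$ with $0<\bar V<V_{\max}=\frac{M-m}{3M+m}v_{\min}$, let $W(t)$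 (the Markov approximation, with the same initial configuration of the atoms and $W(0)=V(0)$) be the velocity of the piston in the dynamics in which the velocity $V'$ of the piston after a collision is replaced by $2\bar V-V'$ if $V'>\bar V$ and by $-2\bar V-V'$ if $V'<-\bar V$. Then there is a constant $d>0$, which depends only on $n_\pm,f_\pm,v_{\min},v_{\max}$, such that for every $\bar V>0$ there is $\varepsilon_0>0$ such that for all $m,M>0$ with $\varepsilon=m/M<\varepsilon_0$ and $\bar V<V_{\max}$, all $V(0)$ with $|V(0)|<\varepsilon^{1/2}$ and all $T>0$, $$P\Big(V(t)=W(t)\ \ \forall t\in(0,T)\Big)\ \ge\ 1-T^2\,\varepsilon^{\,d\ln\ln \varepsilon^{-1}} .$$ Here the event includes that both dynamics are well defined on $(0,T)$ (finitely many collisions before each time $t<T$, no two of them simultaneous), and the bound means that some measurable subset of the event has at least this probability. -/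

import Mathlib

open MeasureTheory ProbabilityTheory Set
open scoped ENNReal NNReal

namespace Piston

/-! ### The gas -/

/-- `f` is a symmetric probability density on the line that satisfies the velocity cutoff:
it vanishes at all velocities `v` with `|v| ≤ vmin` or `|v| ≥ vmax`. -/
structure IsCutoffDensity (vmin vmax : ℝ) (f : ℝ → ℝ) : Prop where
  measurable : Measurable f
  nonneg : ∀ v, 0 ≤ f v
  integrable : Integrable f volume
  integral_eq_one : ∫ v, f v = 1
  symm : ∀ v, f (-v) = f v
  cutoff : ∀ v, |v| ≤ vmin ∨ vmax ≤ |v| → f v = 0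

/-- Pressure balance (mechanical equilibrium) between the left gas, with spatial density `nL` and
velocity density `fL`, and the right gas, with `nR` and `fR`. -/
def PressureBalance (nL nR : ℝ) (fL fR : ℝ → ℝ) : Prop :=
  nL * ∫ v in Ioi (0 : ℝ), v ^ 2 * fL v = nR * ∫ v in Ioi (0 : ℝ), v ^ 2 * fR v

/-- The density `p(x, v)` of the initial gas: `nR * fR v` to the right of the origin,
`nL * fL v` to the left of it. -/
noncomputable def gasDensity (nL nR : ℝ) (fL fR : ℝ → ℝ) (z : ℝ × ℝ) : ℝ :=
  if 0 < z.1 then nR * fR z.2 else if z.1 < 0 then nL * fL z.2 else 0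

/-- The measure `p(x, v) dx dv` on the plane of positions and velocities. -/
noncomputable def gasIntensity (nL nR : ℝ) (fL fR : ℝ → ℝ) : Measure (ℝ × ℝ) :=
  volume.withDensity fun z => ENNReal.ofReal (gasDensity nL nR fL fR z)

/-- The random set of points `S` is a Poisson process with intensity measure `Λ` (a measure
without atoms, so that all points are simple): the number of points in a measurable set `D` of
finite intensity has the Poisson distribution with parameter `Λ D`, and the numbers of points in
pairwise disjoint sets are independent. -/
structure IsPoissonProcess {Ω E : Type*} [MeasurableSpace Ω] [MeasurableSpace E]
    (μ : Measure Ω) (Λ : Measure E) (S : Ω → Set E) : Prop where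
  measurable_count : ∀ D : Set E, MeasurableSet D → Measurable fun ω => (S ω ∩ D).encard
  map_count : ∀ D : Set E, MeasurableSet D → Λ D ≠ ∞ →
    μ.map (fun ω => (S ω ∩ D).encard)
      = (poissonMeasure (Λ D).toNNReal).map (fun k : ℕ => (k : ℕ∞))
  indep_count : ∀ (k : ℕ) (D : Fin k → Set E), (∀ i, MeasurableSet (D i)) →
    Pairwise (fun i j => Disjoint (D i) (D j)) →
    iIndepFun (fun i ω => (S ω ∩ D i).encard) μ

/-! ### The dynamics of the piston -/

/-- A state of the system piston + gas, at the time `time`: the position and the velocity of the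
piston, and the set of the atoms, each given by its current position and velocity. -/
structure State where
  time : ℝ
  pos : ℝ
  vel : ℝ
  atoms : Set (ℝ × ℝ)

/-- The velocity of the piston after the elastic collision of the piston (mass `M`, velocity `V`)
with an atom (mass `m`, velocity `v`). -/
noncomputable def pistonAfter (m M V v : ℝ) : ℝ :=
  (M - m) / (M + m) * V + 2 * m / (M + m) * v

/-- The velocity of the atom after that collision. -/
noncomputable def atomAfter (m M V v : ℝ) : ℝ :=
  -((M - m) / (M + m)) * v + 2 * M / (M + m) * V

/-- Reflection of a velocity at `b` and `-b`. -/
noncomputable def reflectAt (b w : ℝ) : ℝ :=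
  if b < w then 2 * b - w else if w < -b then -2 * b - w else w

/-- In free motion started from the state `s`, the atom `a` and the piston, which are at different
places in the state `s`, meet after the time `τ > 0`. (An atom that has just collided is at the
place of the piston and has another velocity, so that it does not meet it again before
the velocity of the piston changes.) -/
def Meets (s : State) (a : ℝ × ℝ) (τ : ℝ) : Prop :=
  0 < τ ∧ a.1 ≠ s.pos ∧ a.1 + a.2 * τ = s.pos + s.vel * τ

/-- The first collision after the state `s` takes place after the time `τ`, with the atom `a`
and with no other atom. -/
def IsNextCollision (s : State) (a : ℝ × ℝ) (τ : ℝ) : Prop :=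
  a ∈ s.atoms ∧ Meets s a τ ∧ ∀ b ∈ s.atoms, b ≠ a → ∀ σ ≤ τ, ¬ Meets s b σ

/-- The state right after the collision with the atom `a` that takes place after the time `τ`.
All atoms and the piston move freely for the time `τ`; then the atom `a` gets the velocity
`atomAfter`, and the piston the velocity `rule (pistonAfter ..)`. Elastic collisions are
`rule = id`. -/
noncomputable def State.collide (m M : ℝ) (rule : ℝ → ℝ) (s : State) (a : ℝ × ℝ) (τ : ℝ) :
    State where
  time := s.time + τ
  pos := s.pos + s.vel * τ
  vel := rule (pistonAfter m M s.vel a.2)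
  atoms := insert (s.pos + s.vel * τ, atomAfter m M s.vel a.2)
    ((fun b : ℝ × ℝ => (b.1 + b.2 * τ, b.2)) '' (s.atoms \ {a}))

/-- `s'` is the state right after the first collision that follows the state `s`. -/
def Step (m M : ℝ) (rule : ℝ → ℝ) (s s' : State) : Prop :=
  ∃ a τ, IsNextCollision s a τ ∧ s' = s.collide m M rule a τ

/-- The state at time `0`: the piston is at the origin with velocity `V₀`. -/
def initState (V₀ : ℝ) (A : Set (ℝ × ℝ)) : State where
  time := 0
  pos := 0
  vel := V₀
  atoms := A

/-- With the collision rule `rule`, initial velocity `V₀` of the piston and initial configuration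
`A` of the atoms, the dynamics is defined up to and including the time `t`, and the velocity of the
piston at the time `t` is `v`: finitely many collisions lead to a state with piston velocity `v`
from which no further collision occurs up to the time `t`. -/
def HasVelocityAt (m M : ℝ) (rule : ℝ → ℝ) (V₀ : ℝ) (A : Set (ℝ × ℝ)) (t v : ℝ) : Prop :=
  ∃ s, Relation.ReflTransGen (Step m M rule) (initState V₀ A) s ∧ s.time ≤ t ∧
    (∀ a ∈ s.atoms, ∀ τ, Meets s a τ → t < s.time + τ) ∧ s.vel = v

/-- `V(t) = v`: the true velocity of the piston, whose collisions with the atoms are elastic. -/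
def TrueVelocity (m M V₀ : ℝ) (A : Set (ℝ × ℝ)) (t v : ℝ) : Prop :=
  HasVelocityAt m M id V₀ A t v

/-- `W(t) = w`: the Markov approximation, in which the velocity of the piston after a collision is
reflected at `b` and `-b`. -/
def MarkovVelocity (m M b V₀ : ℝ) (A : Set (ℝ × ℝ)) (t w : ℝ) : Prop :=
  HasVelocityAt m M (reflectAt b) V₀ A t w

/-- A piston that is slower than this bound collides with every atom at most once. -/
noncomputable def maxSpeed (m M vmin : ℝ) : ℝ := (M - m) / (3 * M + m) * vmin

/-- For the initial configuration `A` of the atoms, both velocities are defined on `(0, T)`, and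
they coincide there. -/
def VelocitiesCoincide (m M b V₀ : ℝ) (A : Set (ℝ × ℝ)) (T : ℝ) : Prop :=
  ∀ t ∈ Ioo 0 T, ∃ v, TrueVelocity m M V₀ A t v ∧ MarkovVelocity m M b V₀ A t v

/-! ### The velocity is well defined -/

theorem Meets.unique {s : State} {a : ℝ × ℝ} {τ σ : ℝ} (h : Meets s a τ) (h' : Meets s a σ) :
    τ = σ := by
  obtain ⟨-, h2, h3⟩ := h
  obtain ⟨-, -, h6⟩ := h'
  have h7 : (a.2 - s.vel) * (τ - σ) = 0 := by linear_combination h3 - h6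
  rcases mul_eq_zero.mp h7 with h8 | h8
  · exact absurd (by linear_combination h3 - τ * h8) h2
  · linarith

theorem step_rightUnique (m M : ℝ) (rule : ℝ → ℝ) : Relator.RightUnique (Step m M rule) := by
  rintro s _ _ ⟨a, τ, ⟨ha, hm, hn⟩, rfl⟩ ⟨b, σ, ⟨hb, hm', hn'⟩, rfl⟩
  have hab : a = b := by
    by_contra hne
    rcases le_total τ σ with h | h
    · exact hn' a ha hne τ h hm
    · exact hn b hb (Ne.symm hne) σ h hm'
  subst hab
  rw [hm.unique hm']

theorem time_le_of_reaches {m M : ℝ} {rule : ℝ → ℝ} {s s' : State}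
    (h : Relation.ReflTransGen (Step m M rule) s s') : s.time ≤ s'.time := by
  induction h with
  | refl => exact le_rfl
  | tail _ h ih =>
    obtain ⟨a, τ, ⟨-, ⟨hτ, -⟩, -⟩, rfl⟩ := h
    exact ih.trans (le_add_of_nonneg_right hτ.le)

/-- At every time there is at most one velocity of the piston. -/
theorem HasVelocityAt.unique {m M : ℝ} {rule : ℝ → ℝ} {V₀ : ℝ} {A : Set (ℝ × ℝ)} {t v w : ℝ}
    (h : HasVelocityAt m M rule V₀ A t v) (h' : HasVelocityAt m M rule V₀ A t w) : v = w := by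
  have key : ∀ s s' : State, Relation.ReflTransGen (Step m M rule) s s' →
      (∀ a ∈ s.atoms, ∀ τ, Meets s a τ → t < s.time + τ) → s'.time ≤ t → s = s' := by
    intro s s' hr hs ht
    rcases hr.cases_head with h | ⟨c, ⟨a, τ, ⟨ha, hm, -⟩, rfl⟩, hc⟩
    · exact h
    · have h1 := time_le_of_reaches hc
      have h2 := hs a ha τ hm
      simp only [State.collide] at h1
      linarith
  obtain ⟨s, hr, ht, hs, rfl⟩ := h
  obtain ⟨s', hr', ht', hs', rfl⟩ := h'
  rcases Relation.ReflTransGen.total_of_right_unique (step_rightUnique m M rule) hr hr' with h | h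
  · rw [key s s' h hs ht']
  · rw [key s' s h hs' ht]

end Piston

/-!
While the speed of the piston stays below the cutoff `b`, no velocity is reflected, so the two
dynamics agree, and the piston meets every atom at most once; hence the atoms that hit it come with
their initial velocities and are counted by the initial Poisson process. It therefore suffices to
confine the piston to speeds at most `b / 2`.

A single collision changes the velocity of the piston by `O(ε)`. In a window of time of length
`κ / ε`, with `κ` small, `O(κ / ε)` atoms can reach the piston, which change its velocity by at
most `b / 8`. Suppose that the piston has speed at least `b / 4` at the beginning of the window, and
sort the atoms that hit it by speed. If the number in each narrow bin of speeds is close to its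
mean, then pressure balance makes the momentum received from the front larger than the momentum
received from behind, because the atoms in front approach the piston faster, and the piston does
not gain speed. So a speed at most `b / 2` at the beginning of a window persists to its end.

It is enough to control these counts when the piston is at the points of a grid of mesh of order
`κ / ε`. Time `T ≥ 1` requires `O(T)` windows with `O(T)` grid points each, and the Chernoff bound
makes an atypical count at one of them exponentially improbable in `1 / ε`. For `T ≤ 1` the speed
exceeds `b / 2` only if of order `1 / ε` atoms are within reach, and two of these account for the
factor `T ^ 2`. The resulting `T ^ 2 * (C * exp (-c / ε))` is smaller than the bound of the theorem.
-/

namespace Piston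

/-! ### Collisions of a slow piston -/

/-- The parameters for which a piston of speed at most `b` meets every atom at most once. -/
structure SlowRegime (m M b vmin : ℝ) : Prop where
  m_pos : 0 < m
  M_pos : 0 < M
  b_pos : 0 < b
  vmin_pos : 0 < vmin
  lt_maxSpeed : b < maxSpeed m M vmin

/-- The factor by which the relative velocity of an atom is transferred to the piston. -/
noncomputable def kick (m M : ℝ) : ℝ := 2 * m / (M + m)

theorem kick_pos {m M : ℝ} (hm : 0 < m) (hM : 0 < M) : 0 < kick m M := by
  unfold kick; positivity

theorem kick_le {m M : ℝ} (hm : 0 < m) (hM : 0 < M) : kick m M ≤ 2 * (m / M) := by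
  unfold kick
  rw [mul_div_assoc]
  gcongr
  linarith

theorem pistonAfter_eq_add_kick_mul {m M : ℝ} (h : M + m ≠ 0) (V v : ℝ) :
    pistonAfter m M V v = V + kick m M * (v - V) := by
  unfold pistonAfter kick
  field_simp
  ring

theorem atomAfter_neg (m M V v : ℝ) : atomAfter m M (-V) (-v) = -atomAfter m M V v := by
  unfold atomAfter; ring

theorem reflectAt_of_abs_le {b w : ℝ} (h : |w| ≤ b) : reflectAt b w = w := by
  obtain ⟨h₁, h₂⟩ := abs_le.mp h
  rw [reflectAt, if_neg (by linarith), if_neg (by linarith)]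

namespace SlowRegime

variable {m M b vmin V v : ℝ}

theorem mul_lt_mul_vmin (h : SlowRegime m M b vmin) : b * (3 * M + m) < (M - m) * vmin := by
  have hden : 0 < 3 * M + m := by linarith [h.M_pos, h.m_pos]
  have hlt := h.lt_maxSpeed
  rwa [maxSpeed, div_mul_eq_mul_div, lt_div_iff₀ hden] at hlt

theorem three_mul_lt_vmin (h : SlowRegime m M b vmin) : 3 * b < vmin := by
  have hm := mul_pos h.m_pos h.b_pos
  have hm' := mul_pos h.m_pos h.vmin_pos
  refine lt_of_mul_lt_mul_right ?_ h.M_pos.le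
  linarith [h.mul_lt_mul_vmin]

theorem lt_vmin (h : SlowRegime m M b vmin) : b < vmin := by
  linarith [h.three_mul_lt_vmin, h.b_pos]

theorem lt_atomAfter (h : SlowRegime m M b vmin) (hV : |V| ≤ b) (hv : v < -vmin) :
    b < atomAfter m M V v := by
  have hM := h.M_pos
  have hrecede := h.mul_lt_mul_vmin
  have hmM : 0 < M - m := by
    have : 0 < b * (3 * M + m) := mul_pos h.b_pos (by linarith [h.m_pos])
    exact pos_of_mul_pos_left (this.trans hrecede) h.vmin_pos.le
  have hsum : 0 < M + m := add_pos hM h.m_pos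
  have hafter : atomAfter m M V v = (-(M - m) * v + 2 * M * V) / (M + m) := by
    unfold atomAfter; field_simp
  rw [hafter, lt_div_iff₀ hsum]
  nlinarith [mul_le_mul_of_nonneg_left (neg_le_of_abs_le hV) hM.le]

theorem atomAfter_lt (h : SlowRegime m M b vmin) (hV : |V| ≤ b) (hv : vmin < v) :
    atomAfter m M V v < -b := by
  have := h.lt_atomAfter (V := -V) (v := -v) (by rwa [abs_neg]) (by linarith)
  rw [atomAfter_neg] at this
  linarith

end SlowRegime

/-- The free flight of an atom for the time `t`. -/
def freeFlight (t : ℝ) (a : ℝ × ℝ) : ℝ × ℝ := (a.1 + a.2 * t, a.2)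

theorem freeFlight_freeFlight (t τ : ℝ) (a : ℝ × ℝ) :
    freeFlight τ (freeFlight t a) = freeFlight (t + τ) a := by
  simp only [freeFlight, Prod.mk.injEq, and_true]; ring

theorem freeFlight_injective (t : ℝ) : Function.Injective (freeFlight t) := by
  intro a c h
  simp only [freeFlight, Prod.mk.injEq] at h
  ext
  · have := h.1
    rw [h.2] at this
    linarith
  · exact h.2

/-- The position at the time `t` of the piston in free motion from the state `s`. -/
def State.posAt (s : State) (t : ℝ) : ℝ := s.pos + s.vel * (t - s.time)

theorem State.posAt_eq_add (s : State) (t t' : ℝ) :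
    s.posAt t' = s.posAt t + s.vel * (t' - t) := by
  unfold State.posAt; ring

theorem State.posAt_collide (m M : ℝ) (rule : ℝ → ℝ) (s : State) (p : ℝ × ℝ) (τ : ℝ) :
    (s.collide m M rule p τ).posAt (s.time + τ) = s.posAt (s.time + τ) := by
  simp only [State.posAt, State.collide]; ring

theorem Meets.freeFlight_fst_eq {s : State} {a : ℝ × ℝ} {τ : ℝ}
    (h : Meets s (freeFlight s.time a) τ) : a.1 + a.2 * (s.time + τ) = s.posAt (s.time + τ) := by
  have := h.2.2
  simp only [freeFlight] at this
  unfold State.posAt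
  linarith

/-- The atom `p` moves away from any piston of speed at most `b`. -/
def Away (b : ℝ) (s : State) (p : ℝ × ℝ) : Prop :=
  (s.pos ≤ p.1 ∧ b < p.2) ∨ (p.1 ≤ s.pos ∧ p.2 < -b)

theorem Away.not_meets {b : ℝ} {s : State} {p : ℝ × ℝ} {τ : ℝ} (h : Away b s p)
    (hs : |s.vel| ≤ b) : ¬ Meets s p τ := by
  rintro ⟨hτ, hne, hmeet⟩
  obtain ⟨hs₁, hs₂⟩ := abs_le.mp hs
  rcases h with ⟨hpos, hvel⟩ | ⟨hpos, hvel⟩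
  · have := lt_of_le_of_ne hpos (Ne.symm hne)
    nlinarith
  · have := lt_of_le_of_ne hpos hne
    nlinarith

theorem Away.collide {m M b : ℝ} {rule : ℝ → ℝ} {s : State} {p q : ℝ × ℝ} {τ : ℝ}
    (h : Away b s q) (hs : |s.vel| ≤ b) (hτ : 0 ≤ τ) :
    Away b (s.collide m M rule p τ) (freeFlight τ q) := by
  obtain ⟨hs₁, hs₂⟩ := abs_le.mp hs
  simp only [Away, State.collide, freeFlight]
  rcases h with ⟨hpos, hvel⟩ | ⟨hpos, hvel⟩
  · exact Or.inl ⟨by nlinarith, hvel⟩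
  · exact Or.inr ⟨by nlinarith, hvel⟩

/-- No collision takes place after the state `s` up to the time `t`. -/
def QuietUntil (s : State) (t : ℝ) : Prop :=
  ∀ a ∈ s.atoms, ∀ τ, Meets s a τ → t < s.time + τ

theorem quietUntil_time (s : State) : QuietUntil s s.time :=
  fun _ _ _ hm => lt_add_of_pos_right _ hm.1

/-- The displacement of the atom from the piston is continuous in time, so it cannot change its
sign without a meeting. -/
theorem mul_sub_pos_of_not_meets {s : State} {p : ℝ × ℝ} {x τ : ℝ} (hτ : 0 ≤ τ)
    (hx : 0 < x * (p.1 - s.pos)) (hn : ∀ σ ≤ τ, ¬ Meets s p σ) :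
    0 < x * (p.1 + p.2 * τ - (s.pos + s.vel * τ)) := by
  by_contra! hle
  obtain ⟨σ, hσ, hzero⟩ := intermediate_value_Icc' hτ
    (f := fun σ => x * (p.1 + p.2 * σ - (s.pos + s.vel * σ))) (by fun_prop)
    (show (0 : ℝ) ∈ Icc _ _ from ⟨hle, by simpa using hx.le⟩)
  have hx0 : x ≠ 0 := left_ne_zero_of_mul hx.ne'
  have hmeet : p.1 + p.2 * σ = s.pos + s.vel * σ :=
    sub_eq_zero.mp ((mul_eq_zero_iff_left hx0).mp hzero)
  have hne : p.1 ≠ s.pos := sub_ne_zero.mp (right_ne_zero_of_mul hx.ne')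
  have hσ0 : σ ≠ 0 := by
    rintro rfl
    exact hne (by simpa using hmeet)
  exact hn σ hσ.2 ⟨lt_of_le_of_ne hσ.1 hσ0.symm, hne, hmeet⟩

theorem mul_sub_neg_iff_of_abs_lt {x v V : ℝ} (h : |V| < |v|) : x * (v - V) < 0 ↔ x * v < 0 := by
  obtain ⟨h₁, h₂⟩ := abs_lt.mp h
  rcases le_total 0 v with hv | hv
  · rw [abs_of_nonneg hv] at h₁ h₂
    have hv : 0 < v := by linarith
    rw [← neg_pos, ← neg_mul, mul_pos_iff_of_pos_right (by linarith), ← neg_pos (a := x * v),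
      ← neg_mul, mul_pos_iff_of_pos_right hv]
  · rw [abs_of_nonpos hv] at h₁ h₂
    have hv : 0 < -v := by linarith
    rw [← neg_pos, ← mul_neg, mul_pos_iff_of_pos_right (by linarith), ← neg_pos (a := x * v),
      ← mul_neg, mul_pos_iff_of_pos_right hv]

/-! ### Histories -/

/-- The time at which an atom `a` meets the piston that moves along the line `p.1 + p.2 * t`. -/
noncomputable def meetTime (p a : ℝ × ℝ) : ℝ := (p.1 - a.1) / (a.2 - p.2)

/-- The line `p.1 + p.2 * t` along which the piston moves after elastic collisions with the
atoms of a list, the last one first; the atoms are given by their initial data. -/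
noncomputable def pistonLine (m M V₀ : ℝ) : List (ℝ × ℝ) → ℝ × ℝ
  | [] => (0, V₀)
  | a :: l =>
    (a.1 + a.2 * meetTime (pistonLine m M V₀ l) a
        - pistonAfter m M (pistonLine m M V₀ l).2 a.2 * meetTime (pistonLine m M V₀ l) a,
      pistonAfter m M (pistonLine m M V₀ l).2 a.2)

/-- The configurations of the gas with the velocity cutoff for which no two atoms meet the piston
simultaneously and only finitely many atoms are within reach. -/
structure RegularGas (m M V₀ vmin vmax : ℝ) (A : Set (ℝ × ℝ)) : Prop where
  ne_zero : ∀ a ∈ A, a.1 ≠ 0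
  lt_speed : ∀ a ∈ A, vmin < |a.2|
  speed_lt : ∀ a ∈ A, |a.2| < vmax
  finite : ∀ r : ℝ, (A ∩ {a | |a.1| ≤ r}).Finite
  generic : ∀ (l : List (ℝ × ℝ)) (a c : ℝ × ℝ), (c :: a :: l).Nodup →
    (∀ x ∈ c :: a :: l, x ∈ A) →
    c.1 + c.2 * meetTime (pistonLine m M V₀ l) a ≠ a.1 + a.2 * meetTime (pistonLine m M V₀ l) a

/-- The state `s` arises from the initial configuration `A`, under both collision rules, by
collisions with the atoms of the list `l`, the last one first, and the piston is slow. The atoms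
are named by their initial data; `side` and `hit` use the sign of `a.1`, the side from which
the atom `a` comes. -/
structure History (m M b V₀ : ℝ) (A : Set (ℝ × ℝ)) (s : State) (l : List (ℝ × ℝ)) : Prop where
  vel_eq : s.vel = (pistonLine m M V₀ l).2
  pos_eq : s.pos = (pistonLine m M V₀ l).1 + s.vel * s.time
  slow : |s.vel| ≤ b
  nodup : l.Nodup
  mem : ∀ a ∈ l, a ∈ A
  atoms : ∀ p ∈ s.atoms, (∃ a ∈ A, a ∉ l ∧ p = freeFlight s.time a) ∨ Away b s p
  free : ∀ a ∈ A, a ∉ l → freeFlight s.time a ∈ s.atoms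
  side : ∀ a ∈ A, a ∉ l → 0 < a.1 * (a.1 + a.2 * s.time - s.pos)
  hit : ∀ a ∈ l, a.1 * a.2 < 0 ∧ a.1 * (a.1 + a.2 * s.time - s.pos) ≤ 0
  reach : Relation.ReflTransGen (Step m M id) (initState V₀ A) s
  reach_reflect : Relation.ReflTransGen (Step m M (reflectAt b)) (initState V₀ A) s

namespace History

variable {m M b V₀ vmin vmax : ℝ} {A : Set (ℝ × ℝ)} {s : State} {l : List (ℝ × ℝ)}
  {a c : ℝ × ℝ} {t τ : ℝ}

theorem init (hV : |V₀| ≤ b) (hA : ∀ a ∈ A, a.1 ≠ 0) :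
    History m M b V₀ A (initState V₀ A) [] where
  vel_eq := rfl
  pos_eq := by simp [initState, pistonLine]
  slow := hV
  nodup := List.nodup_nil
  mem := by simp
  atoms p hp := Or.inl ⟨p, hp, by simp, by simp [initState, freeFlight]⟩
  free a ha _ := by simpa [initState, freeFlight] using ha
  side a ha _ := by simpa [initState] using mul_self_pos.mpr (hA a ha)
  hit := by simp
  reach := .refl
  reach_reflect := .refl

theorem time_nonneg (hs : History m M b V₀ A s l) : 0 ≤ s.time :=
  time_le_of_reaches hs.reach

theorem abs_vel_lt_speed (hs : History m M b V₀ A s l) (hR : SlowRegime m M b vmin)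
    (hA : RegularGas m M V₀ vmin vmax A) (ha : a ∈ A) : |s.vel| < |a.2| :=
  hs.slow.trans_lt (hR.lt_vmin.trans (hA.lt_speed a ha))

theorem side_posAt (hs : History m M b V₀ A s l) (ht : s.time ≤ t) (ha : a ∈ A) (hal : a ∉ l)
    (hn : ∀ σ ≤ t - s.time, ¬ Meets s (freeFlight s.time a) σ) :
    0 < a.1 * (a.1 + a.2 * t - s.posAt t) := by
  have := mul_sub_pos_of_not_meets (sub_nonneg.mpr ht) (hs.side a ha hal) hn
  convert this using 2
  simp only [freeFlight, State.posAt]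
  ring

theorem hit_posAt (hs : History m M b V₀ A s l) (hR : SlowRegime m M b vmin)
    (hA : RegularGas m M V₀ vmin vmax A) (ht : s.time ≤ t) (hal : a ∈ l) :
    a.1 * (a.1 + a.2 * t - s.posAt t) ≤ 0 := by
  obtain ⟨happroach, hpassed⟩ := hs.hit a hal
  have hspeed := hs.abs_vel_lt_speed hR hA (hs.mem a hal)
  have hrecede := (mul_sub_neg_iff_of_abs_lt hspeed).mpr happroach
  have hsplit : a.1 * (a.1 + a.2 * t - s.posAt t)
      = a.1 * (a.1 + a.2 * s.time - s.pos) + a.1 * (a.2 - s.vel) * (t - s.time) := by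
    unfold State.posAt; ring
  have := mul_nonpos_of_nonpos_of_nonneg hrecede.le (sub_nonneg.mpr ht)
  linarith

theorem meetTime_eq (hs : History m M b V₀ A s l) (hR : SlowRegime m M b vmin)
    (hA : RegularGas m M V₀ vmin vmax A) (ha : a ∈ A) (hm : Meets s (freeFlight s.time a) τ) :
    meetTime (pistonLine m M V₀ l) a = s.time + τ := by
  have hne : a.2 - s.vel ≠ 0 := by
    rw [sub_ne_zero]
    rintro h
    exact (hs.abs_vel_lt_speed hR hA ha).ne' (by rw [h])
  have hmeet := hm.2.2
  simp only [freeFlight] at hmeet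
  rw [meetTime, ← hs.vel_eq, div_eq_iff hne]
  linear_combination -hmeet - hs.pos_eq

theorem mul_velocity_neg_of_meets (hs : History m M b V₀ A s l) (hR : SlowRegime m M b vmin)
    (hA : RegularGas m M V₀ vmin vmax A) (ha : a ∈ A) (hal : a ∉ l)
    (hm : Meets s (freeFlight s.time a) τ) : a.1 * a.2 < 0 := by
  rw [← mul_sub_neg_iff_of_abs_lt (hs.abs_vel_lt_speed hR hA ha)]
  have hside := hs.side a ha hal
  have hmeet := hm.2.2
  simp only [freeFlight] at hmeet
  have : a.1 * (a.1 + a.2 * s.time - s.pos) = -(a.1 * (a.2 - s.vel)) * τ := by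
    linear_combination a.1 * hmeet
  rw [this] at hside
  linarith [pos_of_mul_pos_left hside hm.1.le]

theorem finite_setOf_meets (hs : History m M b V₀ A s l) (hA : RegularGas m M V₀ vmin vmax A)
    (t : ℝ) : {a ∈ A | ∃ τ, s.time + τ ≤ t ∧ Meets s (freeFlight s.time a) τ}.Finite := by
  refine (hA.finite (|s.pos| + |s.vel| * t + vmax * t)).subset ?_
  rintro a ⟨ha, τ, hτt, hm⟩
  refine ⟨ha, ?_⟩
  have htime := hs.time_nonneg
  have hτ := hm.1
  have hpiston : |s.vel * τ| ≤ |s.vel| * t := by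
    rw [abs_mul, abs_of_pos hτ]
    gcongr
    linarith
  have hatom : |a.2 * (s.time + τ)| ≤ vmax * t := by
    rw [abs_mul, abs_of_nonneg (by linarith : 0 ≤ s.time + τ)]
    exact mul_le_mul (hA.speed_lt a ha).le hτt (by linarith)
      ((abs_nonneg _).trans (hA.speed_lt a ha).le)
  have hstart : a.1 = s.pos + s.vel * τ - a.2 * (s.time + τ) := by
    have := hm.2.2
    simp only [freeFlight] at this
    linarith
  calc |a.1| = |s.pos + s.vel * τ - a.2 * (s.time + τ)| := by rw [← hstart]
    _ ≤ |s.pos| + |s.vel * τ| + |a.2 * (s.time + τ)| :=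
      (abs_sub _ _).trans (by gcongr; exact abs_add_le _ _)
    _ ≤ _ := by gcongr

theorem eq_of_meets (hs : History m M b V₀ A s l) (hR : SlowRegime m M b vmin)
    (hA : RegularGas m M V₀ vmin vmax A) (ha : a ∈ A) (hal : a ∉ l) (hc : c ∈ A) (hcl : c ∉ l)
    (hma : Meets s (freeFlight s.time a) τ) (hmc : Meets s (freeFlight s.time c) τ) : c = a := by
  by_contra hca
  refine hA.generic l a c ?_ ?_ ?_
  · simp [hca, hal, hcl, hs.nodup]
  · simp only [List.mem_cons]
    rintro x (rfl | rfl | hx)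
    exacts [hc, ha, hs.mem x hx]
  · rw [hs.meetTime_eq hR hA ha hma, hma.freeFlight_fst_eq, hmc.freeFlight_fst_eq]

theorem exists_meets_of_not_quietUntil (hs : History m M b V₀ A s l) (hq : ¬ QuietUntil s t) :
    ∃ a ∈ A, a ∉ l ∧ ∃ τ, s.time + τ ≤ t ∧ Meets s (freeFlight s.time a) τ := by
  unfold QuietUntil at hq
  push Not at hq
  obtain ⟨p, hp, τ, hm, hτ⟩ := hq
  rcases hs.atoms p hp with ⟨a, ha, hal, rfl⟩ | haway
  · exact ⟨a, ha, hal, τ, hτ, hm⟩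
  · exact absurd hm (haway.not_meets hs.slow)

theorem quietUntil_or_isNextCollision (hs : History m M b V₀ A s l) (hR : SlowRegime m M b vmin)
    (hA : RegularGas m M V₀ vmin vmax A) (t : ℝ) :
    QuietUntil s t ∨ ∃ a ∈ A, a ∉ l ∧ ∃ τ, s.time + τ ≤ t ∧
      IsNextCollision s (freeFlight s.time a) τ := by
  refine or_iff_not_imp_left.mpr fun hq => ?_
  let B : Set (ℝ × ℝ) :=
    {a | a ∈ A ∧ a ∉ l ∧ ∃ τ, s.time + τ ≤ t ∧ Meets s (freeFlight s.time a) τ}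
  have hfin : B.Finite := (hs.finite_setOf_meets hA t).subset fun _ h => ⟨h.1, h.2.2⟩
  obtain ⟨a, ⟨ha, hal, τ, hτ, hm⟩, hfirst⟩ := Set.exists_min_image B
    (fun a => meetTime (pistonLine m M V₀ l) a) hfin (hs.exists_meets_of_not_quietUntil hq)
  refine ⟨a, ha, hal, τ, hτ, hs.free a ha hal, hm, fun p hp hpa σ hσ hmp => ?_⟩
  rcases hs.atoms p hp with ⟨c, hc, hcl, rfl⟩ | haway
  · have hle := hfirst c ⟨hc, hcl, σ, by linarith, hmp⟩
    rw [hs.meetTime_eq hR hA ha hm, hs.meetTime_eq hR hA hc hmp] at hle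
    obtain rfl : σ = τ := by linarith
    exact hpa (by rw [hs.eq_of_meets hR hA ha hal hc hcl hm hmp])
  · exact haway.not_meets hs.slow hmp

theorem away_collide (hs : History m M b V₀ A s l) (hR : SlowRegime m M b vmin)
    (hA : RegularGas m M V₀ vmin vmax A) (ha : a ∈ A) (rule : ℝ → ℝ) (τ : ℝ) :
    Away b (s.collide m M rule (freeFlight s.time a) τ)
      (s.pos + s.vel * τ, atomAfter m M s.vel a.2) := by
  rcases lt_abs.mp (hA.lt_speed a ha) with h | h
  · exact Or.inr ⟨le_rfl, hR.atomAfter_lt hs.slow h⟩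
  · exact Or.inl ⟨le_rfl, hR.lt_atomAfter hs.slow (by linarith)⟩

theorem atoms_collide (hs : History m M b V₀ A s l) (hR : SlowRegime m M b vmin)
    (hA : RegularGas m M V₀ vmin vmax A) (ha : a ∈ A)
    (hm : Meets s (freeFlight s.time a) τ) {rule : ℝ → ℝ} {p : ℝ × ℝ}
    (hp : p ∈ (s.collide m M rule (freeFlight s.time a) τ).atoms) :
    (∃ c ∈ A, c ∉ a :: l ∧ p = freeFlight (s.time + τ) c) ∨
      Away b (s.collide m M rule (freeFlight s.time a) τ) p := by
  obtain rfl | ⟨q, ⟨hq, hqa⟩, rfl⟩ := hp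
  · exact Or.inr (hs.away_collide hR hA ha rule τ)
  · rcases hs.atoms q hq with ⟨c, hc, hcl, rfl⟩ | haway
    · refine Or.inl ⟨c, hc, ?_, freeFlight_freeFlight _ _ _⟩
      rintro (_ | ⟨_, h⟩)
      exacts [hqa rfl, hcl h]
    · exact Or.inr (haway.collide hs.slow hm.1.le)

theorem hit_collide (hs : History m M b V₀ A s l) (hR : SlowRegime m M b vmin)
    (hA : RegularGas m M V₀ vmin vmax A) (ha : a ∈ A) (hal : a ∉ l)
    (hm : Meets s (freeFlight s.time a) τ) (hc : c ∈ a :: l) :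
    c.1 * c.2 < 0 ∧ c.1 * (c.1 + c.2 * (s.time + τ) - s.posAt (s.time + τ)) ≤ 0 := by
  rcases List.mem_cons.mp hc with rfl | hc
  · refine ⟨hs.mul_velocity_neg_of_meets hR hA ha hal hm, ?_⟩
    rw [hm.freeFlight_fst_eq, sub_self, mul_zero]
  · exact ⟨(hs.hit c hc).1, hs.hit_posAt hR hA (by linarith [hm.1]) hc⟩

theorem collide (hs : History m M b V₀ A s l) (hR : SlowRegime m M b vmin)
    (hA : RegularGas m M V₀ vmin vmax A) (ha : a ∈ A) (hal : a ∉ l)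
    (hnext : IsNextCollision s (freeFlight s.time a) τ)
    (hslow : |pistonAfter m M s.vel a.2| ≤ b) :
    History m M b V₀ A (s.collide m M id (freeFlight s.time a) τ) (a :: l) := by
  obtain ⟨-, hm, hfirst⟩ := id hnext
  have htime := hs.meetTime_eq hR hA ha hm
  have hpos : (s.collide m M id (freeFlight s.time a) τ).pos = s.posAt (s.time + τ) := by
    simp only [State.collide, State.posAt]; ring
  have hremains : ∀ c ∈ A, c ∉ a :: l → c ∉ l ∧ freeFlight s.time c ≠ freeFlight s.time a :=
    fun c _ hcl => ⟨fun h => hcl (List.mem_cons_of_mem _ h),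
      fun h => hcl (freeFlight_injective _ h ▸ List.mem_cons_self)⟩
  constructor
  case vel_eq => simp only [State.collide, pistonLine, id, freeFlight, hs.vel_eq]
  case pos_eq =>
    rw [hpos, ← hm.freeFlight_fst_eq]
    simp only [State.collide, pistonLine, id, htime, ← hs.vel_eq, freeFlight]
    ring
  case slow => exact hslow
  case nodup => exact List.nodup_cons.mpr ⟨hal, hs.nodup⟩
  case mem => exact List.forall_mem_cons.mpr ⟨ha, hs.mem⟩
  case atoms => exact fun p hp => hs.atoms_collide hR hA ha hm hp
  case free =>
    intro c hc hcl
    obtain ⟨hcl, hca⟩ := hremains c hc hcl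
    exact Or.inr ⟨_, ⟨hs.free c hc hcl, hca⟩, freeFlight_freeFlight _ _ _⟩
  case side =>
    intro c hc hcl
    obtain ⟨hcl, hca⟩ := hremains c hc hcl
    rw [hpos]
    exact hs.side_posAt (t := s.time + τ) (by linarith [hm.1]) hc hcl fun σ hσ =>
      hfirst _ (hs.free c hc hcl) hca σ (by linarith)
  case hit =>
    intro c hc
    rw [hpos]
    exact hs.hit_collide hR hA ha hal hm hc
  case reach => exact hs.reach.tail ⟨_, τ, hnext, rfl⟩
  case reach_reflect =>
    refine hs.reach_reflect.tail ⟨_, τ, hnext, ?_⟩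
    simp only [State.collide, freeFlight, reflectAt_of_abs_le hslow, id]

end History
/-! ### Counting atoms -/

/-- The number of points of `A` in `D` is finite and at most `r`. -/
def CountLE {E : Type*} (A D : Set E) (r : ℝ) : Prop :=
  ∃ n : ℕ, (A ∩ D).encard = n ∧ (n : ℝ) ≤ r

/-- The number of points of `A` in `D` is infinite or at least `r`. -/
def CountGE {E : Type*} (A D : Set E) (r : ℝ) : Prop :=
  ∀ n : ℕ, (A ∩ D).encard = n → r ≤ (n : ℝ)

/-- The atoms that in free motion are at the time `t` within the distance `r` of `p`. -/
def nearby (p r t : ℝ) : Set (ℝ × ℝ) := {a | |a.1 + a.2 * t - p| ≤ r}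

/-- The atoms from the side `σ = 1` (right) or `σ = -1` (left) with speed in `[u, u')` that at
the time `t₀` are beyond `lo` and at the time `t₁` not beyond `hi`, in free motion. Positions are
multiplied by `σ`, so that these atoms move in the negative direction. -/
def crossing (σ lo hi t₀ t₁ u u' : ℝ) : Set (ℝ × ℝ) :=
  {a | 0 < σ * a.1 ∧ u ≤ -(σ * a.2) ∧ -(σ * a.2) < u' ∧ lo < σ * a.1 + σ * a.2 * t₀ ∧
    σ * a.1 + σ * a.2 * t₁ ≤ hi}

section Counts

variable {E : Type*} {A D D' : Set E} {r : ℝ}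

theorem CountLE.nonneg (h : CountLE A D r) : 0 ≤ r := by
  obtain ⟨n, -, hr⟩ := h
  exact n.cast_nonneg.trans hr

theorem CountLE.card_le (h : CountLE A D r) {P : Finset E} (hP : ∀ a ∈ P, a ∈ A ∩ D) :
    (P.card : ℝ) ≤ r := by
  obtain ⟨n, hn, hr⟩ := h
  have hle : (P : Set E).encard ≤ (A ∩ D).encard := Set.encard_le_encard hP
  rw [hn, Set.encard_coe_eq_coe_finsetCard] at hle
  exact le_trans (mod_cast hle) hr

theorem CountLE.length_le (h : CountLE A D r) {l : List E} (hl : l.Nodup)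
    (hmem : ∀ a ∈ l, a ∈ A ∩ D) : (l.length : ℝ) ≤ r := by
  classical
  rw [← List.toFinset_card_of_nodup hl]
  exact h.card_le fun a ha => hmem a (List.mem_toFinset.mp ha)

theorem CountLE.mono (h : CountLE A D r) (hD : D' ⊆ D) : CountLE A D' r := by
  obtain ⟨n, hn, hr⟩ := h
  have hle : (A ∩ D').encard ≤ n := hn ▸ Set.encard_le_encard (Set.inter_subset_inter_right A hD)
  obtain ⟨k, hk, hkn⟩ := ENat.le_natCast_iff.mp hle
  exact ⟨k, hk, le_trans (mod_cast hkn) hr⟩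

theorem CountGE.le_card (h : CountGE A D r) {Q : Finset E} (hQ : ∀ a ∈ A ∩ D, a ∈ Q) :
    r ≤ (Q.card : ℝ) := by
  have hle : (A ∩ D).encard ≤ (Q : Set E).encard := Set.encard_le_encard hQ
  rw [Set.encard_coe_eq_coe_finsetCard] at hle
  obtain ⟨k, hk, hkQ⟩ := ENat.le_natCast_iff.mp hle
  exact (h k hk).trans (mod_cast hkQ)

theorem CountGE.mono (h : CountGE A D r) (hD : D ⊆ D') : CountGE A D' r := by
  intro n hn
  have hle : (A ∩ D).encard ≤ n := hn ▸ Set.encard_le_encard (Set.inter_subset_inter_right A hD)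
  obtain ⟨k, hk, hkn⟩ := ENat.le_natCast_iff.mp hle
  exact (h k hk).trans (mod_cast hkn)

end Counts

/-! ### Windows of time -/

/-- `History` at the time `t`: the last collision before `t` has led to the state `s`. -/
structure HistoryAt (m M b V₀ : ℝ) (A : Set (ℝ × ℝ)) (t : ℝ) (s : State) (l : List (ℝ × ℝ)) :
    Prop where
  history : History m M b V₀ A s l
  time_le : s.time ≤ t
  quiet : QuietUntil s t

theorem mul_pos_iff_of_mul_pos {σ x y : ℝ} (h : 0 < σ * x) : 0 < x * y ↔ 0 < σ * y := by
  rcases pos_and_pos_or_neg_and_neg_of_mul_pos h with ⟨hσ, hx⟩ | ⟨hσ, hx⟩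
  · rw [mul_pos_iff_of_pos_left hσ, mul_pos_iff_of_pos_left hx]
  · rw [← neg_mul_neg x, ← neg_mul_neg σ, mul_pos_iff_of_pos_left (neg_pos.mpr hσ),
      mul_pos_iff_of_pos_left (neg_pos.mpr hx)]

namespace HistoryAt

variable {m M b V₀ vmin vmax t σ : ℝ} {A : Set (ℝ × ℝ)} {s : State} {l : List (ℝ × ℝ)}
  {a : ℝ × ℝ}

theorem init (hV : |V₀| ≤ b) (hA : ∀ a ∈ A, a.1 ≠ 0) :
    HistoryAt m M b V₀ A 0 (initState V₀ A) [] where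
  history := History.init hV hA
  time_le := le_rfl
  quiet := quietUntil_time _

theorem velocities (h : HistoryAt m M b V₀ A t s l) :
    ∃ v, TrueVelocity m M V₀ A t v ∧ MarkovVelocity m M b V₀ A t v :=
  ⟨s.vel, ⟨s, h.history.reach, h.time_le, h.quiet, rfl⟩,
    ⟨s, h.history.reach_reflect, h.time_le, h.quiet, rfl⟩⟩

theorem mul_sub_pos (h : HistoryAt m M b V₀ A t s l) (ha : a ∈ A) (hal : a ∉ l) :
    0 < a.1 * (a.1 + a.2 * t - s.posAt t) :=
  h.history.side_posAt h.time_le ha hal fun τ hτ hm => by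
    linarith [h.quiet _ (h.history.free a ha hal) τ hm]

theorem lt_of_notMem (h : HistoryAt m M b V₀ A t s l) (ha : a ∈ A) (hal : a ∉ l)
    (hside : 0 < σ * a.1) : σ * s.posAt t < σ * a.1 + σ * a.2 * t := by
  have := (mul_pos_iff_of_mul_pos hside).mp (h.mul_sub_pos ha hal)
  linarith

theorem le_of_mem (h : HistoryAt m M b V₀ A t s l) (hR : SlowRegime m M b vmin)
    (hA : RegularGas m M V₀ vmin vmax A) (hal : a ∈ l) (hside : 0 < σ * a.1) :
    σ * a.1 + σ * a.2 * t ≤ σ * s.posAt t := by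
  have := (mul_pos_iff_of_mul_pos hside).not.mp
    (not_lt.mpr (h.history.hit_posAt hR hA h.time_le hal))
  linarith

theorem mul_velocity_eq (h : HistoryAt m M b V₀ A t s l) (hσ : |σ| = 1) (hal : a ∈ l)
    (hside : 0 < σ * a.1) : σ * a.2 = -|a.2| := by
  have := (mul_pos_iff_of_mul_pos (y := -a.2) hside).mp (by linarith [(h.history.hit a hal).1])
  rw [← one_mul |a.2|, ← hσ, ← abs_mul, abs_of_neg (by linarith), neg_neg]

end HistoryAt

/-- From the time `t₀` and the state `s₀` to the time `t` and the state `s` the piston has met the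
atoms of the list `l`, and its velocity has changed by at most `w`. If the component of its
velocity in the direction `σ = 1` or `σ = -1` has been at least `c`, then so has its displacement
per unit of time, and the collision with the atom `a` has contributed at most
`kick m M * (σ * a.2 - c)` to that component. -/
structure Window (m M b V₀ vmax w : ℝ) (A : Set (ℝ × ℝ)) (t₀ : ℝ) (s₀ : State)
    (l₀ : List (ℝ × ℝ)) (t : ℝ) (s : State) (l : List (ℝ × ℝ)) : Prop where
  at_end : HistoryAt m M b V₀ A t s (l ++ l₀)
  le_time : t₀ ≤ t
  vel_sub : |s.vel - s₀.vel| ≤ kick m M * (2 * vmax) * l.length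
  vel_sub_le : |s.vel - s₀.vel| ≤ w
  mul_vel_le : ∀ σ, |σ| = 1 → ∀ c, c + w ≤ σ * s₀.vel →
    σ * s.vel ≤ σ * s₀.vel + kick m M * (l.map fun a => σ * a.2 - c).sum
  le_mul_posAt : ∀ σ, |σ| = 1 → ∀ c, c + w ≤ σ * s₀.vel →
    σ * s₀.posAt t₀ + c * (t - t₀) ≤ σ * s.posAt t

namespace Window

variable {m M b V₀ vmin vmax w t₀ t₁ t t' τ σ c r : ℝ} {A : Set (ℝ × ℝ)} {s₀ s : State}
  {l₀ l : List (ℝ × ℝ)} {a : ℝ × ℝ}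

theorem refl (h : HistoryAt m M b V₀ A t₀ s₀ l₀) (hw : 0 ≤ w) :
    Window m M b V₀ vmax w A t₀ s₀ l₀ t₀ s₀ [] where
  at_end := h
  le_time := le_rfl
  vel_sub := by simp
  vel_sub_le := by simpa using hw
  mul_vel_le := by simp
  le_mul_posAt := by simp

theorem le_mul_vel (h : Window m M b V₀ vmax w A t₀ s₀ l₀ t s l) (hσ : |σ| = 1)
    (hc : c + w ≤ σ * s₀.vel) : c ≤ σ * s.vel := by
  have : |σ * (s.vel - s₀.vel)| ≤ w := by
    rw [abs_mul, hσ, one_mul]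
    exact h.vel_sub_le
  linarith [neg_le_of_abs_le this]

theorem le_mul_posAt_of_le (h : Window m M b V₀ vmax w A t₀ s₀ l₀ t s l) (ht : t ≤ t')
    (hσ : |σ| = 1) (hc : c + w ≤ σ * s₀.vel) :
    σ * s₀.posAt t₀ + c * (t' - t₀) ≤ σ * s.posAt t' := by
  rw [s.posAt_eq_add t t']
  linarith [h.le_mul_posAt σ hσ c hc,
    mul_le_mul_of_nonneg_right (h.le_mul_vel hσ hc) (sub_nonneg.mpr ht)]

theorem extend (h : Window m M b V₀ vmax w A t₀ s₀ l₀ t s l) (ht : t ≤ t')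
    (hq : QuietUntil s t') : Window m M b V₀ vmax w A t₀ s₀ l₀ t' s l where
  at_end := ⟨h.at_end.history, h.at_end.time_le.trans ht, hq⟩
  le_time := h.le_time.trans ht
  vel_sub := h.vel_sub
  vel_sub_le := h.vel_sub_le
  mul_vel_le := h.mul_vel_le
  le_mul_posAt _ hσ _ hc := h.le_mul_posAt_of_le ht hσ hc

theorem abs_posAt_sub_le (h : Window m M b V₀ vmax w A t₀ s₀ l₀ t s l) (ht : t ≤ t')
    (hb : |s₀.vel| + w ≤ b) : |s.posAt t' - s₀.posAt t₀| ≤ b * (t' - t₀) := by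
  have hright := h.le_mul_posAt_of_le ht (σ := 1) (c := -b) abs_one
    (by linarith [neg_abs_le s₀.vel])
  have hleft := h.le_mul_posAt_of_le ht (σ := -1) (c := -b) (by simp)
    (by linarith [le_abs_self s₀.vel])
  rw [abs_le]
  constructor <;> linarith

/-- An atom that the piston has met has changed sides, so its distance from the piston at the time
`t₀` is at most its displacement relative to the piston. -/
theorem mem_nearby (h : Window m M b V₀ vmax w A t₀ s₀ l₀ t s l)
    (h₀ : HistoryAt m M b V₀ A t₀ s₀ l₀) (hR : SlowRegime m M b vmin)
    (hA : RegularGas m M V₀ vmin vmax A) (hb : |s₀.vel| + w ≤ b) (ht : t ≤ t') (ht₁ : t' ≤ t₁)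
    (ha : a ∈ A) (hal : a ∉ l₀) (hpassed : a.1 * (a.1 + a.2 * t' - s.posAt t') ≤ 0) :
    a ∈ nearby (s₀.posAt t₀) (2 * vmax * (t₁ - t₀)) t₀ := by
  set y₀ := a.1 + a.2 * t₀ - s₀.posAt t₀ with hy₀
  set y := a.1 + a.2 * t' - s.posAt t' with hy
  have hspeed := hA.speed_lt a ha
  have hbv : b < vmax := hR.lt_vmin.trans ((hA.lt_speed a ha).trans hspeed)
  have hlen : 0 ≤ t' - t₀ := by linarith [h.le_time]
  have hside : 0 < a.1 * y₀ := h₀.mul_sub_pos ha hal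
  have hopposite : y₀ * y ≤ 0 :=
    not_lt.mp ((mul_pos_iff_of_mul_pos (mul_comm a.1 y₀ ▸ hside)).not.mp (not_lt.mpr hpassed))
  have hpiston := h.abs_posAt_sub_le ht hb
  calc |y₀| ≤ |y₀ - y| := sq_le_sq.mp (by linarith [sq_nonneg y])
    _ = |s.posAt t' - s₀.posAt t₀ - a.2 * (t' - t₀)| := by rw [hy₀, hy]; ring_nf
    _ ≤ b * (t' - t₀) + |a.2| * (t' - t₀) := by
      refine (abs_sub _ _).trans (add_le_add hpiston ?_)
      rw [abs_mul, abs_of_nonneg hlen]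
    _ ≤ vmax * (t' - t₀) + vmax * (t' - t₀) := by gcongr
    _ = 2 * vmax * (t' - t₀) := by ring
    _ ≤ 2 * vmax * (t₁ - t₀) := by
      have : 0 ≤ vmax := (abs_nonneg _).trans hspeed.le
      gcongr

theorem length_add_one_le (h : Window m M b V₀ vmax w A t₀ s₀ l₀ t s l)
    (h₀ : HistoryAt m M b V₀ A t₀ s₀ l₀) (hR : SlowRegime m M b vmin)
    (hA : RegularGas m M V₀ vmin vmax A) (hb : |s₀.vel| + w ≤ b)
    (hcount : CountLE A (nearby (s₀.posAt t₀) (2 * vmax * (t₁ - t₀)) t₀) r)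
    (ha : a ∈ A) (hal : a ∉ l ++ l₀) (hm : Meets s (freeFlight s.time a) τ)
    (ht : t ≤ s.time + τ) (ht₁ : s.time + τ ≤ t₁) : (l.length : ℝ) + 1 ≤ r := by
  have hnodup := List.nodup_append.mp h.at_end.history.nodup
  rw [List.mem_append, not_or] at hal
  rw [← Nat.cast_add_one, ← List.length_cons (a := a)]
  refine hcount.length_le (List.nodup_cons.mpr ⟨hal.1, hnodup.1⟩)
    (List.forall_mem_cons.mpr ⟨⟨ha, ?_⟩, fun x hx => ?_⟩)
  · refine h.mem_nearby h₀ hR hA hb ht ht₁ ha hal.2 ?_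
    rw [hm.freeFlight_fst_eq, sub_self, mul_zero]
  · have hx' := List.mem_append_left l₀ hx
    have hxA := h.at_end.history.mem x hx'
    exact ⟨hxA, h.mem_nearby h₀ hR hA hb le_rfl (ht.trans ht₁) hxA
      (fun hx₀ => hnodup.2.2 x hx x hx₀ rfl)
      (h.at_end.history.hit_posAt hR hA h.at_end.time_le hx')⟩

theorem collide (h : Window m M b V₀ vmax w A t₀ s₀ l₀ t s l) (hR : SlowRegime m M b vmin)
    (hA : RegularGas m M V₀ vmin vmax A) (hb : |s₀.vel| + w ≤ b)
    (hw : kick m M * (2 * vmax) * (l.length + 1) ≤ w) (ha : a ∈ A) (hal : a ∉ l ++ l₀)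
    (hnext : IsNextCollision s (freeFlight s.time a) τ) (ht : t ≤ s.time + τ) :
    Window m M b V₀ vmax w A t₀ s₀ l₀ (s.time + τ)
      (s.collide m M id (freeFlight s.time a) τ) (a :: l) := by
  have hkick := kick_pos hR.m_pos hR.M_pos
  have hafter := pistonAfter_eq_add_kick_mul (add_pos hR.M_pos hR.m_pos).ne' s.vel a.2
  have hrel : |a.2 - s.vel| ≤ 2 * vmax := by
    linarith [abs_sub a.2 s.vel, hA.speed_lt a ha, h.at_end.history.abs_vel_lt_speed hR hA ha]
  have hstep : |pistonAfter m M s.vel a.2 - s₀.vel| ≤ kick m M * (2 * vmax) * (l.length + 1) := by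
    calc |pistonAfter m M s.vel a.2 - s₀.vel|
        = |(s.vel - s₀.vel) + kick m M * (a.2 - s.vel)| := by rw [hafter]; ring_nf
      _ ≤ |s.vel - s₀.vel| + kick m M * |a.2 - s.vel| := by
        refine (abs_add_le _ _).trans ?_
        rw [abs_mul, abs_of_pos hkick]
      _ ≤ kick m M * (2 * vmax) * l.length + kick m M * (2 * vmax) := by
        gcongr
        exact h.vel_sub
      _ = _ := by ring
  have hslow : |pistonAfter m M s.vel a.2| ≤ b := by
    linarith [abs_sub_abs_le_abs_sub (pistonAfter m M s.vel a.2) s₀.vel]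
  constructor
  case at_end =>
    exact ⟨h.at_end.history.collide hR hA ha hal hnext hslow, le_rfl, quietUntil_time _⟩
  case le_time => exact h.le_time.trans ht
  case vel_sub => simpa [State.collide, freeFlight] using hstep
  case vel_sub_le => simpa [State.collide, freeFlight] using hstep.trans hw
  case mul_vel_le =>
    intro σ hσ c hc
    have hvel := h.mul_vel_le σ hσ c hc
    have hgain := mul_le_mul_of_nonneg_left (h.le_mul_vel hσ hc) hkick.le
    simp only [State.collide, freeFlight, id, hafter, List.map_cons, List.sum_cons]
    linarith
  case le_mul_posAt =>
    intro σ hσ c hc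
    rw [State.posAt_collide]
    exact h.le_mul_posAt_of_le ht hσ hc

end Window

theorem HistoryAt.exists_window {m M b V₀ vmin vmax w t₀ t₁ t r : ℝ} {A : Set (ℝ × ℝ)} {s₀ : State}
    {l₀ : List (ℝ × ℝ)} (h₀ : HistoryAt m M b V₀ A t₀ s₀ l₀) (hR : SlowRegime m M b vmin)
    (hA : RegularGas m M V₀ vmin vmax A) (hv : 0 ≤ vmax) (hb : |s₀.vel| + w ≤ b)
    (hcount : CountLE A (nearby (s₀.posAt t₀) (2 * vmax * (t₁ - t₀)) t₀) r)
    (hr : kick m M * (2 * vmax) * r ≤ w) (ht₀ : t₀ ≤ t) (ht₁ : t ≤ t₁) :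
    ∃ s l, Window m M b V₀ vmax w A t₀ s₀ l₀ t s l := by
  have hkick := kick_pos hR.m_pos hR.M_pos
  have hw : 0 ≤ w := le_trans (mul_nonneg (by positivity) hcount.nonneg) hr
  by_contra! hnone
  have hlong : ∀ n : ℕ, (n : ℝ) ≤ r ∧ ∃ t' ≤ t, ∃ s l,
      Window m M b V₀ vmax w A t₀ s₀ l₀ t' s l ∧ l.length = n := by
    intro n
    induction n with
    | zero => exact ⟨by simpa using hcount.nonneg, t₀, ht₀, s₀, [], .refl h₀ hw, rfl⟩
    | succ n ih =>
      obtain ⟨-, t', ht', s, l, hW, rfl⟩ := ih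
      rcases hW.at_end.history.quietUntil_or_isNextCollision hR hA t with
        hq | ⟨a, ha, hal, τ, hτ, hnext⟩
      · exact absurd (hW.extend ht' hq) (hnone s l)
      · have hlater := (hW.at_end.quiet _ hnext.1 τ hnext.2.1).le
        have hlen := hW.length_add_one_le h₀ hR hA hb hcount ha hal hnext.2.1 hlater (hτ.trans ht₁)
        refine ⟨mod_cast hlen, _, hτ, _, _, hW.collide hR hA hb ?_ ha hal hnext hlater, rfl⟩
        exact le_trans (by gcongr) hr
  obtain ⟨n, hn⟩ := exists_nat_gt r
  exact hn.not_ge (hlong n).1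
/-! ### Bins of speeds -/

/-- The lower end of the bin number `i` when the speeds above `vmin` are divided into bins of
length `δ`. -/
noncomputable def binEdge (vmin δ : ℝ) (i : ℕ) : ℝ := vmin + i * δ

section Bins

variable {vmin vmax δ η c : ℝ} {K i : ℕ}

theorem binEdge_succ (vmin δ : ℝ) (i : ℕ) : binEdge vmin δ (i + 1) = binEdge vmin δ i + δ := by
  unfold binEdge; push_cast; ring

theorem le_binEdge (hδ : 0 ≤ δ) (i : ℕ) : vmin ≤ binEdge vmin δ i :=
  le_add_of_nonneg_right (by positivity)

theorem binEdge_succ_le (hδ : 0 ≤ δ) (hi : i < K) :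
    binEdge vmin δ (i + 1) ≤ binEdge vmin δ K := by
  unfold binEdge
  gcongr
  exact hi

/-- The number of the bin that contains the speed `u`. -/
noncomputable def speedBin (vmin δ u : ℝ) : ℕ := ⌊(u - vmin) / δ⌋₊

theorem speedBin_eq_iff {u : ℝ} (hδ : 0 < δ) (hu : vmin ≤ u) :
    speedBin vmin δ u = i ↔ binEdge vmin δ i ≤ u ∧ u < binEdge vmin δ (i + 1) := by
  rw [speedBin, Nat.floor_eq_iff (div_nonneg (sub_nonneg.mpr hu) hδ.le), le_div_iff₀ hδ,
    div_lt_iff₀ hδ, binEdge, binEdge]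
  push_cast
  rw [le_sub_iff_add_le', sub_lt_iff_lt_add']

theorem speedBin_lt {u : ℝ} (hδ : 0 < δ) (hu : vmin ≤ u) (hK : u < binEdge vmin δ K) :
    speedBin vmin δ u < K := by
  rw [speedBin, Nat.floor_lt (div_nonneg (sub_nonneg.mpr hu) hδ.le), div_lt_iff₀ hδ]
  exact sub_lt_iff_lt_add'.mpr hK

variable {E : Type*} {P : Finset E} {u : E → ℝ}

theorem sum_eq_sum_bins (hδ : 0 < δ) (hu : ∀ a ∈ P, vmin ≤ u a ∧ u a < binEdge vmin δ K)
    (g : E → ℝ) :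
    ∑ a ∈ P, g a = ∑ i ∈ Finset.range K,
      ∑ a ∈ P with binEdge vmin δ i ≤ u a ∧ u a < binEdge vmin δ (i + 1), g a := by
  rw [← Finset.sum_fiberwise_of_maps_to (t := Finset.range K) (g := fun a => speedBin vmin δ (u a))
    fun a ha => Finset.mem_range.mpr (speedBin_lt hδ (hu a ha).1 (hu a ha).2)]
  refine Finset.sum_congr rfl fun i _ => Finset.sum_congr (Finset.filter_congr fun a ha => ?_)
    fun _ _ => rfl
  exact speedBin_eq_iff hδ (hu a ha).1

theorem sum_sub_le_of_card_le {up : ℕ → ℝ} (hδ : 0 < δ) (hc : c ≤ vmin)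
    (hu : ∀ a ∈ P, vmin ≤ u a ∧ u a < binEdge vmin δ K)
    (hup : ∀ i < K, (({a ∈ P | binEdge vmin δ i ≤ u a ∧ u a < binEdge vmin δ (i + 1)}).card : ℝ)
      ≤ up i) :
    ∑ a ∈ P, (u a - c) ≤ ∑ i ∈ Finset.range K, (binEdge vmin δ (i + 1) - c) * up i := by
  rw [sum_eq_sum_bins hδ hu]
  refine Finset.sum_le_sum fun i hi => ?_
  refine (Finset.sum_le_card_nsmul _ _ (binEdge vmin δ (i + 1) - c) fun a ha => ?_).trans ?_
  · linarith [(Finset.mem_filter.mp ha).2.2]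
  · rw [nsmul_eq_mul, mul_comm]
    exact mul_le_mul_of_nonneg_left (hup i (Finset.mem_range.mp hi))
      (sub_nonneg.mpr (hc.trans (le_binEdge hδ.le _)))

theorem le_sum_add_of_le_card {lo : ℕ → ℝ} (hδ : 0 < δ) (hc : -c ≤ vmin)
    (hu : ∀ a ∈ P, vmin ≤ u a ∧ u a < binEdge vmin δ K)
    (hlo : ∀ i < K, lo i
      ≤ (({a ∈ P | binEdge vmin δ i ≤ u a ∧ u a < binEdge vmin δ (i + 1)}).card : ℝ)) :
    ∑ i ∈ Finset.range K, (binEdge vmin δ i + c) * lo i ≤ ∑ a ∈ P, (u a + c) := by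
  rw [sum_eq_sum_bins hδ hu]
  refine Finset.sum_le_sum fun i hi => ?_
  refine le_trans ?_ (Finset.card_nsmul_le_sum _ _ (binEdge vmin δ i + c) fun a ha => ?_)
  · rw [nsmul_eq_mul, mul_comm _ (binEdge vmin δ i + c)]
    exact mul_le_mul_of_nonneg_left (hlo i (Finset.mem_range.mp hi))
      (by linarith [le_binEdge (vmin := vmin) hδ.le i])
  · linarith [(Finset.mem_filter.mp ha).2.1]

end Bins

/-! ### The restoring force -/

/-- The atoms of the list `l` that come from the side `σ`. -/
noncomputable def hitFrom (σ : ℝ) (l : List (ℝ × ℝ)) : Finset (ℝ × ℝ) :=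
  {a ∈ l.toFinset | 0 < σ * a.1}

theorem mem_hitFrom {σ : ℝ} {l : List (ℝ × ℝ)} {a : ℝ × ℝ} :
    a ∈ hitFrom σ l ↔ a ∈ l ∧ 0 < σ * a.1 := by
  rw [hitFrom, Finset.mem_filter, List.mem_toFinset]

theorem crossing_subset {σ lo lo' hi hi' t₀ t₁ u u' : ℝ} (hlo : lo' ≤ lo) (hhi : hi ≤ hi') :
    crossing σ lo hi t₀ t₁ u u' ⊆ crossing σ lo' hi' t₀ t₁ u u' :=
  fun _ ⟨hside, hu, hu', hbeyond, hbefore⟩ =>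
    ⟨hside, hu, hu', hlo.trans_lt hbeyond, hbefore.trans hhi⟩

/-- For every bin of speeds, the number of atoms from the side `σ` that cross the point `σ * x`
from `t₀` to `t₁` is between the given bounds. -/
def CountsBetween (A : Set (ℝ × ℝ)) (vmin δ t₀ t₁ : ℝ) (K : ℕ) (up lo : ℕ → ℝ) (σ x : ℝ) : Prop :=
  ∀ i < K,
    CountLE A (crossing σ x x t₀ t₁ (binEdge vmin δ i) (binEdge vmin δ (i + 1))) (up i) ∧
    CountGE A (crossing σ x x t₀ t₁ (binEdge vmin δ i) (binEdge vmin δ (i + 1))) (lo i)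

namespace Window

variable {m M b V₀ vmin vmax w t₀ t₁ σ c : ℝ} {A : Set (ℝ × ℝ)} {s₀ s : State}
  {l₀ l : List (ℝ × ℝ)} {a : ℝ × ℝ}

theorem nodup (h : Window m M b V₀ vmax w A t₀ s₀ l₀ t₁ s l) : l.Nodup :=
  (List.nodup_append.mp h.at_end.history.nodup).1

theorem mem_of_mem (h : Window m M b V₀ vmax w A t₀ s₀ l₀ t₁ s l) (ha : a ∈ l) : a ∈ A :=
  h.at_end.history.mem a (List.mem_append_left l₀ ha)

theorem mem_hitFrom_iff (h : Window m M b V₀ vmax w A t₀ s₀ l₀ t₁ s l)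
    (h₀ : HistoryAt m M b V₀ A t₀ s₀ l₀) (hR : SlowRegime m M b vmin)
    (hA : RegularGas m M V₀ vmin vmax A) (hσ : |σ| = 1) (u u' : ℝ) :
    (a ∈ hitFrom σ l ∧ u ≤ |a.2| ∧ |a.2| < u') ↔
      a ∈ A ∩ crossing σ (σ * s₀.posAt t₀) (σ * s.posAt t₁) t₀ t₁ u u' := by
  rw [mem_hitFrom]
  constructor
  · rintro ⟨⟨hal, hside⟩, hu, hu'⟩
    have hal' := List.mem_append_left l₀ hal
    have hal₀ : a ∉ l₀ := fun ha =>
      (List.nodup_append.mp h.at_end.history.nodup).2.2 a hal a ha rfl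
    have hvel := h.at_end.mul_velocity_eq hσ hal' hside
    exact ⟨h.mem_of_mem hal, hside, by rwa [hvel, neg_neg], by rwa [hvel, neg_neg],
      h₀.lt_of_notMem (h.mem_of_mem hal) hal₀ hside, h.at_end.le_of_mem hR hA hal' hside⟩
  · rintro ⟨ha, hside, hu, hu', hbeyond, hbefore⟩
    have hal : a ∈ l ++ l₀ := by
      by_contra hal
      exact (h.at_end.lt_of_notMem ha hal hside).not_ge hbefore
    have hvel := h.at_end.mul_velocity_eq hσ hal hside
    rw [hvel, neg_neg] at hu hu'
    refine ⟨⟨(List.mem_append.mp hal).resolve_right fun hal₀ => ?_, hside⟩, hu, hu'⟩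
    exact (h₀.le_of_mem hR hA hal₀ hside).not_gt hbeyond

theorem sum_mul_velocity_sub (h : Window m M b V₀ vmax w A t₀ s₀ l₀ t₁ s l)
    (hA : ∀ a ∈ A, a.1 ≠ 0) (hσ : |σ| = 1) :
    (l.map fun a => σ * a.2 - c).sum
      = ∑ a ∈ hitFrom (-σ) l, (|a.2| - c) - ∑ a ∈ hitFrom σ l, (|a.2| + c) := by
  have hother : {a ∈ l.toFinset | ¬ 0 < σ * a.1} = hitFrom (-σ) l := by
    refine Finset.filter_congr fun a ha => ?_
    have hne : σ * a.1 ≠ 0 := mul_ne_zero (by rintro rfl; simp at hσ)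
      (hA a (h.mem_of_mem (List.mem_toFinset.mp ha)))
    rw [not_lt, neg_mul, neg_pos, hne.le_iff_lt]
  rw [← List.sum_toFinset _ h.nodup, ← Finset.sum_filter_add_sum_filter_not _ fun a => 0 < σ * a.1,
    hother, ← hitFrom, add_comm, sub_eq_add_neg, ← Finset.sum_neg_distrib]
  congr 1
  · refine Finset.sum_congr rfl fun a ha => ?_
    obtain ⟨hal, hside⟩ := mem_hitFrom.mp ha
    linarith [h.at_end.mul_velocity_eq (by rwa [abs_neg]) (List.mem_append_left l₀ hal) hside]
  · refine Finset.sum_congr rfl fun a ha => ?_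
    obtain ⟨hal, hside⟩ := mem_hitFrom.mp ha
    linarith [h.at_end.mul_velocity_eq hσ (List.mem_append_left l₀ hal) hside]

/-- The atoms that push the piston are slower relative to it than those that brake it, since it
moves away from the former and towards the latter. -/
theorem mul_vel_le_of_counts (h : Window m M b V₀ vmax w A t₀ s₀ l₀ t₁ s l)
    (h₀ : HistoryAt m M b V₀ A t₀ s₀ l₀) (hR : SlowRegime m M b vmin)
    (hA : RegularGas m M V₀ vmin vmax A) (hσ : |σ| = 1) {δ : ℝ} {K : ℕ} {up lo : ℝ → ℕ → ℝ}
    (hc : 0 ≤ c) (hcv : c ≤ vmin) (hδ : 0 < δ) (hK : binEdge vmin δ K = vmax)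
    (hcw : c + w ≤ σ * s₀.vel)
    (hcount : ∀ σ, |σ| = 1 →
      CountsBetween A vmin δ t₀ t₁ K (up σ) (lo σ) σ (σ * s₀.posAt t₀))
    (hbal : ∑ i ∈ Finset.range K, (binEdge vmin δ (i + 1) - c) * up (-σ) i
      ≤ ∑ i ∈ Finset.range K, (binEdge vmin δ i + c) * lo σ i) :
    σ * s.vel ≤ σ * s₀.vel := by
  have hσ' : |-σ| = 1 := by rwa [abs_neg]
  have hmoved : σ * s₀.posAt t₀ ≤ σ * s.posAt t₁ := by
    linarith [h.le_mul_posAt σ hσ c hcw, mul_nonneg hc (sub_nonneg.mpr h.le_time)]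
  have hspeed : ∀ σ, ∀ a ∈ hitFrom σ l, vmin ≤ |a.2| ∧ |a.2| < binEdge vmin δ K := by
    intro σ a ha
    have haA := h.mem_of_mem (mem_hitFrom.mp ha).1
    exact ⟨(hA.lt_speed a haA).le, hK ▸ hA.speed_lt a haA⟩
  have hpush := sum_sub_le_of_card_le hδ hcv (hspeed (-σ)) fun i hi =>
    (hcount (-σ) hσ' i hi).1.card_le fun a ha => by
      have := (h.mem_hitFrom_iff h₀ hR hA hσ' _ _).mp (Finset.mem_filter.mp ha)
      exact ⟨this.1, crossing_subset le_rfl (by linarith) this.2⟩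
  have hbrake := le_sum_add_of_le_card (c := c) hδ (by linarith) (hspeed σ) fun i hi =>
    (hcount σ hσ i hi).2.le_card fun a ha => Finset.mem_filter.mpr <|
      (h.mem_hitFrom_iff h₀ hR hA hσ _ _).mpr ⟨ha.1, crossing_subset le_rfl hmoved ha.2⟩
  have hforce : (l.map fun a => σ * a.2 - c).sum ≤ 0 := by
    rw [h.sum_mul_velocity_sub hA.ne_zero hσ]
    linarith
  linarith [h.mul_vel_le σ hσ c hcw,
    mul_nonpos_of_nonneg_of_nonpos (kick_pos hR.m_pos hR.M_pos).le hforce]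

end Window

/-! ### The piston stays slow -/

section

variable {m M b V₀ vmin vmax r : ℝ} {A : Set (ℝ × ℝ)}

theorem velocitiesCoincide_of_few (hR : SlowRegime m M b vmin)
    (hA : RegularGas m M V₀ vmin vmax A) (hv : 0 ≤ vmax) (hV : |V₀| ≤ b / 2) {T : ℝ}
    (hcount : CountLE A (nearby 0 (2 * vmax * T) 0) r)
    (hr : kick m M * (2 * vmax) * r ≤ b / 2) : VelocitiesCoincide m M b V₀ A T := by
  intro t ht
  have hb := hR.b_pos
  have h₀ : HistoryAt m M b V₀ A 0 (initState V₀ A) [] := .init (by linarith) hA.ne_zero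
  obtain ⟨s, l, hW⟩ := h₀.exists_window (w := b / 2) (t₁ := T) hR hA hv
    (by simp only [initState]; linarith) (by simpa [State.posAt, initState] using hcount) hr
    ht.1.le ht.2.le
  exact hW.at_end.velocities

/-- In the window of time from `t` to `t + τ`, for a piston that is at `x` at the time `t`, the
number of atoms within reach is at most `r`, and the numbers of atoms that cross the point `x` are
between the bounds `lo` and `up`. -/
structure TypicalCounts (A : Set (ℝ × ℝ)) (vmin vmax δ τ r : ℝ) (K : ℕ) (up lo : ℝ → ℕ → ℝ)
    (t x : ℝ) : Prop where
  nearby : CountLE A (nearby x (2 * vmax * τ) t) r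
  crossing : ∀ σ, |σ| = 1 → CountsBetween A vmin δ t (t + τ) K (up σ) (lo σ) σ (σ * x)

variable {δ τ : ℝ} {K : ℕ} {up lo : ℝ → ℕ → ℝ}

theorem HistoryAt.exists_window_of_typicalCounts {s₀ : State} {l₀ : List (ℝ × ℝ)} {t₀ t : ℝ}
    (h₀ : HistoryAt m M b V₀ A t₀ s₀ l₀) (hR : SlowRegime m M b vmin)
    (hA : RegularGas m M V₀ vmin vmax A) (hv : 0 ≤ vmax) (hr : kick m M * (2 * vmax) * r ≤ b / 8)
    (hvel : |s₀.vel| ≤ b / 2)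
    (hcount : TypicalCounts A vmin vmax δ τ r K up lo t₀ (s₀.posAt t₀)) (ht : t₀ ≤ t)
    (ht' : t ≤ t₀ + τ) : ∃ s l, Window m M b V₀ vmax (b / 8) A t₀ s₀ l₀ t s l :=
  h₀.exists_window (t₁ := t₀ + τ) hR hA hv (by linarith [hR.b_pos])
    (by rw [add_sub_cancel_left]; exact hcount.nearby) hr ht ht'

theorem Window.abs_vel_le {s₀ s : State} {l₀ l : List (ℝ × ℝ)} {t₀ : ℝ}
    (h : Window m M b V₀ vmax (b / 8) A t₀ s₀ l₀ (t₀ + τ) s l)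
    (h₀ : HistoryAt m M b V₀ A t₀ s₀ l₀) (hR : SlowRegime m M b vmin)
    (hA : RegularGas m M V₀ vmin vmax A) (hδ : 0 < δ) (hK : binEdge vmin δ K = vmax)
    (hbal : ∀ σ, |σ| = 1 → ∑ i ∈ Finset.range K, (binEdge vmin δ (i + 1) - b / 8) * up (-σ) i
      ≤ ∑ i ∈ Finset.range K, (binEdge vmin δ i + b / 8) * lo σ i)
    (hvel : |s₀.vel| ≤ b / 2)
    (hcount : TypicalCounts A vmin vmax δ τ r K up lo t₀ (s₀.posAt t₀)) : |s.vel| ≤ b / 2 := by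
  have hb := hR.b_pos
  have hle : ∀ σ, |σ| = 1 → σ * s.vel ≤ b / 2 := by
    intro σ hσ
    have hstart : σ * s₀.vel ≤ b / 2 := (le_abs_self _).trans (by rwa [abs_mul, hσ, one_mul])
    have hchange : σ * (s.vel - s₀.vel) ≤ b / 8 :=
      (le_abs_self _).trans (by rw [abs_mul, hσ, one_mul]; exact h.vel_sub_le)
    by_cases hfast : b / 8 + b / 8 ≤ σ * s₀.vel
    · exact (h.mul_vel_le_of_counts h₀ hR hA hσ (by linarith) (by linarith [hR.lt_vmin]) hδ hK
        hfast hcount.crossing (hbal σ hσ)).trans hstart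
    · linarith
  exact abs_le'.mpr ⟨by simpa using hle 1 abs_one, by simpa using hle (-1) (by simp)⟩

theorem exists_historyAt_of_typicalCounts (hR : SlowRegime m M b vmin)
    (hA : RegularGas m M V₀ vmin vmax A) (hv : 0 ≤ vmax) (hV : |V₀| ≤ b / 2) {n : ℕ}
    (hτ : 0 ≤ τ) (hδ : 0 < δ) (hK : binEdge vmin δ K = vmax)
    (hr : kick m M * (2 * vmax) * r ≤ b / 8)
    (hbal : ∀ σ, |σ| = 1 → ∑ i ∈ Finset.range K, (binEdge vmin δ (i + 1) - b / 8) * up (-σ) i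
      ≤ ∑ i ∈ Finset.range K, (binEdge vmin δ i + b / 8) * lo σ i)
    (hcount : ∀ k < n, ∀ x : ℝ, |x| ≤ b * (k * τ) →
      TypicalCounts A vmin vmax δ τ r K up lo (k * τ) x) :
    ∀ k ≤ n, ∃ s l, HistoryAt m M b V₀ A (k * τ) s l ∧ |s.vel| ≤ b / 2 ∧
      |s.posAt (k * τ)| ≤ b * (k * τ) := by
  have hb := hR.b_pos
  intro k
  induction k with
  | zero =>
    intro _
    have h₀ : HistoryAt m M b V₀ A 0 (initState V₀ A) [] := .init (by linarith) hA.ne_zero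
    exact ⟨initState V₀ A, [], by simpa using h₀, hV, by simp [State.posAt, initState]⟩
  | succ k ih =>
    intro hk
    obtain ⟨s₀, l₀, h₀, hvel, hpos⟩ := ih (by omega)
    have htyp := hcount k (by omega) _ hpos
    obtain ⟨s, l, hW⟩ := h₀.exists_window_of_typicalCounts hR hA hv hr hvel htyp
      (le_add_of_nonneg_right hτ) le_rfl
    have hmoved := hW.abs_posAt_sub_le le_rfl (by linarith)
    have htime : ((k + 1 : ℕ) : ℝ) * τ = k * τ + τ := by push_cast; ring
    rw [htime]
    refine ⟨s, l ++ l₀, hW.at_end, hW.abs_vel_le h₀ hR hA hδ hK hbal hvel htyp, ?_⟩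
    linarith [abs_sub_abs_le_abs_sub (s.posAt (k * τ + τ)) (s₀.posAt (k * τ))]

theorem velocitiesCoincide_of_typicalCounts (hR : SlowRegime m M b vmin)
    (hA : RegularGas m M V₀ vmin vmax A) (hv : 0 ≤ vmax) (hV : |V₀| ≤ b / 2) {n : ℕ} {T : ℝ}
    (hτ : 0 < τ) (hδ : 0 < δ) (hK : binEdge vmin δ K = vmax)
    (hr : kick m M * (2 * vmax) * r ≤ b / 8)
    (hbal : ∀ σ, |σ| = 1 → ∑ i ∈ Finset.range K, (binEdge vmin δ (i + 1) - b / 8) * up (-σ) i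
      ≤ ∑ i ∈ Finset.range K, (binEdge vmin δ i + b / 8) * lo σ i)
    (hcount : ∀ k < n, ∀ x : ℝ, |x| ≤ b * (k * τ) →
      TypicalCounts A vmin vmax δ τ r K up lo (k * τ) x) (hT : T ≤ n * τ) :
    VelocitiesCoincide m M b V₀ A T := by
  intro t ht
  have hk : ⌊t / τ⌋₊ < n := by
    rw [Nat.floor_lt (div_nonneg ht.1.le hτ.le), div_lt_iff₀ hτ]
    exact ht.2.trans_le hT
  obtain ⟨s₀, l₀, h₀, hvel, hpos⟩ :=
    exists_historyAt_of_typicalCounts hR hA hv hV hτ.le hδ hK hr hbal hcount _ hk.le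
  have hle := (le_div_iff₀ hτ).mp (Nat.floor_le (div_nonneg ht.1.le hτ.le))
  have hlt := (div_lt_iff₀ hτ).mp (Nat.lt_floor_add_one (t / τ))
  obtain ⟨s, l, hW⟩ := h₀.exists_window_of_typicalCounts hR hA hv hr hvel (hcount _ hk _ hpos)
    hle (by linarith)
  exact hW.at_end.velocities

end

/-! ### Poisson processes -/

section PoissonProcess

variable {Ω E : Type*} [MeasurableSpace Ω] [MeasurableSpace E] {μ : Measure Ω} {Λ : Measure E}
  {S : Ω → Set E}

theorem IsPoissonProcess.measure_encard_mem (h : IsPoissonProcess μ Λ S) {D : Set E}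
    (hD : MeasurableSet D) (hΛ : Λ D ≠ ∞) (B : Set ℕ∞) :
    μ {ω | (S ω ∩ D).encard ∈ B} = poissonMeasure (Λ D).toNNReal {k : ℕ | (k : ℕ∞) ∈ B} := by
  have hmap := congrArg (fun ν : Measure ℕ∞ => ν B) (h.map_count D hD hΛ)
  rwa [Measure.map_apply (h.measurable_count D hD) .of_discrete,
    Measure.map_apply measurable_from_top .of_discrete] at hmap

theorem poissonMeasure_compl_zero_le (r : ℝ≥0) : poissonMeasure r {0}ᶜ ≤ r := by
  rw [prob_compl_eq_one_sub (measurableSet_singleton 0), poissonMeasure_singleton,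
    pow_zero, mul_one, Nat.factorial_zero, Nat.cast_one, div_one, ← ENNReal.ofReal_one,
    ← ENNReal.ofReal_sub _ (Real.exp_pos _).le, ← ENNReal.ofReal_coe_nnreal]
  exact ENNReal.ofReal_le_ofReal (by linarith [Real.add_one_le_exp (-(r : ℝ))])

theorem IsPoissonProcess.measure_inter_nonempty_le (h : IsPoissonProcess μ Λ S) {D : Set E}
    (hD : MeasurableSet D) : μ {ω | (S ω ∩ D).Nonempty} ≤ Λ D := by
  by_cases hΛ : Λ D = ∞
  · exact hΛ ▸ le_top
  · have hcount := h.measure_encard_mem hD hΛ {0}ᶜ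
    simp only [mem_compl_iff, mem_singleton_iff, encard_eq_zero, Nat.cast_eq_zero,
      ← nonempty_iff_ne_empty] at hcount
    rw [hcount, ← ENNReal.coe_toNNReal hΛ]
    exact poissonMeasure_compl_zero_le _

theorem IsPoissonProcess.ae_inter_eq_empty (h : IsPoissonProcess μ Λ S) {D : Set E}
    (hD : MeasurableSet D) (h0 : Λ D = 0) : ∀ᵐ ω ∂μ, S ω ∩ D = ∅ := by
  simpa only [ae_iff, ← nonempty_iff_ne_empty, h0, nonpos_iff_eq_zero]
    using h.measure_inter_nonempty_le hD

theorem IsPoissonProcess.ae_finite_inter (h : IsPoissonProcess μ Λ S) {D : Set E}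
    (hD : MeasurableSet D) (hΛ : Λ D ≠ ∞) : ∀ᵐ ω ∂μ, (S ω ∩ D).Finite := by
  rw [ae_iff]
  simpa [encard_eq_top_iff] using h.measure_encard_mem hD hΛ {⊤}

theorem IsPoissonProcess.measure_exists_tuple_mem_le (h : IsPoissonProcess μ Λ S) {k : ℕ}
    {D : Fin k → Set E} (hD : ∀ i, MeasurableSet (D i))
    (hdisj : Pairwise fun i j => Disjoint (D i) (D j)) :
    μ {ω | ∃ z : Fin k → E, ∀ i, z i ∈ S ω ∩ D i} ≤ ∏ i, Λ (D i) := by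
  have hindep := (h.indep_count k D hD hdisj).measure_inter_preimage_eq_mul Finset.univ
    (sets := fun _ => ({0}ᶜ : Set ℕ∞)) (fun _ _ => trivial)
  have hpreimage : ∀ i, (fun ω => (S ω ∩ D i).encard) ⁻¹' {0}ᶜ = {ω | (S ω ∩ D i).Nonempty} :=
    fun i => by ext ω; simp [nonempty_iff_ne_empty]
  simp only [hpreimage, Finset.mem_univ, iInter_true] at hindep
  calc μ {ω | ∃ z : Fin k → E, ∀ i, z i ∈ S ω ∩ D i}
      ≤ μ (⋂ i, {ω | (S ω ∩ D i).Nonempty}) :=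
        measure_mono fun ω ⟨z, hz⟩ => mem_iInter.mpr fun i => ⟨z i, hz i⟩
    _ = ∏ i, μ {ω | (S ω ∩ D i).Nonempty} := hindep
    _ ≤ ∏ i, Λ (D i) := Finset.prod_le_prod' fun i _ => h.measure_inter_nonempty_le (hD i)

theorem exists_box_cover {ι : Type*} [Fintype ι] [Nonempty ι] {N : Set (ι → E)}
    (hN : Measure.pi (fun _ => Λ) N = 0) {r : ℝ≥0∞} (hr : r ≠ 0) :
    ∃ D : ℕ → ι → Set E, (∀ n i, MeasurableSet (D n i)) ∧
      N ⊆ ⋃ n, Set.pi univ (D n) ∧ ∑' n, ∏ i, Λ (D n i) < r := by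
  have hempty : piPremeasure (fun _ : ι => Λ.toOuterMeasure) ∅ = 0 :=
    Finset.prod_eq_zero (Finset.mem_univ (Classical.arbitrary ι)) (by simp)
  have hlt : OuterMeasure.pi (fun _ : ι => Λ.toOuterMeasure) N < r := by
    rw [Measure.pi] at hN
    exact ((le_toMeasure_apply _ _ N).trans_eq hN).trans_lt (pos_iff_ne_zero.mpr hr)
  rw [OuterMeasure.pi, OuterMeasure.boundedBy_eq_ofFunction hempty,
    OuterMeasure.ofFunction_apply] at hlt
  simp only [iInf_lt_iff] at hlt
  obtain ⟨t, hcover, hsum⟩ := hlt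
  refine ⟨fun n i => toMeasurable Λ (Function.eval i '' t n),
    fun n i => measurableSet_toMeasurable _ _,
    hcover.trans (iUnion_mono fun n z hz i _ => subset_toMeasurable _ _ ⟨z, hz, rfl⟩), ?_⟩
  simp only [measure_toMeasurable]
  exact hsum

/-- Independence is available only over disjoint sets, which is why the tuple is confined to a
product of disjoint sets. -/
theorem IsPoissonProcess.ae_tuple_notMem_of_disjoint (h : IsPoissonProcess μ Λ S)
    {k : ℕ} [NeZero k] {N : Set (Fin k → E)} (hN : Measure.pi (fun _ => Λ) N = 0)
    {U : Fin k → Set E} (hU : ∀ i, MeasurableSet (U i))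
    (hdisj : Pairwise fun i j => Disjoint (U i) (U j)) :
    ∀ᵐ ω ∂μ, ∀ z : Fin k → E, (∀ i, z i ∈ S ω ∩ U i) → z ∉ N := by
  rw [ae_iff]
  by_contra hne
  obtain ⟨D, hD, hcover, hsum⟩ := exists_box_cover hN hne
  refine absurd hsum (not_lt.mpr ?_)
  calc _ ≤ μ (⋃ n, {ω | ∃ z : Fin k → E, ∀ i, z i ∈ S ω ∩ (D n i ∩ U i)}) := by
        refine measure_mono fun ω hω => ?_
        simp only [mem_ofPred_eq, not_forall, not_not] at hω
        obtain ⟨z, hz, hzN⟩ := hω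
        obtain ⟨n, hn⟩ := mem_iUnion.mp (hcover hzN)
        exact mem_iUnion.mpr ⟨n, z, fun i => ⟨(hz i).1, hn i (mem_univ i), (hz i).2⟩⟩
    _ ≤ ∑' n, μ {ω | ∃ z : Fin k → E, ∀ i, z i ∈ S ω ∩ (D n i ∩ U i)} := measure_iUnion_le _
    _ ≤ ∑' n, ∏ i, Λ (D n i ∩ U i) := ENNReal.tsum_le_tsum fun n =>
        h.measure_exists_tuple_mem_le (fun i => (hD n i).inter (hU i)) fun i j hij =>
          (hdisj hij).mono inter_subset_right inter_subset_right
    _ ≤ ∑' n, ∏ i, Λ (D n i) := ENNReal.tsum_le_tsum fun n =>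
        Finset.prod_le_prod' fun i _ => measure_mono inter_subset_left

theorem IsPoissonProcess.ae_tuple_notMem [TopologicalSpace E] [T2Space E]
    [SecondCountableTopology E] [OpensMeasurableSpace E] (h : IsPoissonProcess μ Λ S)
    {k : ℕ} [NeZero k] {N : Set (Fin k → E)}
    (hN : Measure.pi (fun _ => Λ) N = 0) :
    ∀ᵐ ω ∂μ, ∀ z : Fin k → E, (∀ i, z i ∈ S ω) → Function.Injective z → z ∉ N := by
  let B := TopologicalSpace.countableBasis E
  have hB : TopologicalSpace.IsTopologicalBasis B := TopologicalSpace.isBasis_countableBasis E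
  have : Countable B := (TopologicalSpace.countable_countableBasis E).to_subtype
  have hdisjoint : ∀ᵐ ω ∂μ, ∀ U : Fin k → B, (Pairwise fun i j => Disjoint (U i : Set E) (U j)) →
      ∀ z : Fin k → E, (∀ i, z i ∈ S ω ∩ U i) → z ∉ N := by
    refine ae_all_iff.mpr fun U => ?_
    by_cases hU : Pairwise fun i j => Disjoint (U i : Set E) (U j)
    · filter_upwards [h.ae_tuple_notMem_of_disjoint hN
        (fun i => (hB.isOpen (U i).2).measurableSet) hU] with ω hω _ using hω
    · exact .of_forall fun ω hU' => absurd hU' hU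
  filter_upwards [hdisjoint] with ω hω z hz hinj
  obtain ⟨O, hO, hOdisj⟩ := (Set.finite_range z).t2_separation
  choose U hU using fun i => hB.exists_subset_of_mem_open (hO (z i)).1 (hO (z i)).2
  refine hω (fun i => ⟨U i, (hU i).1⟩) (fun i j hij => ?_) z fun i => ⟨hz i, (hU i).2.1⟩
  exact (hOdisj (mem_range_self i) (mem_range_self j) (hinj.ne hij)).mono (hU i).2.2 (hU j).2.2

end PoissonProcess

/-! ### No simultaneous collisions -/

theorem measurable_meetTime : Measurable fun q : (ℝ × ℝ) × (ℝ × ℝ) => meetTime q.1 q.2 := by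
  unfold meetTime; fun_prop

theorem measurable_pistonLine_ofFn (m M V₀ : ℝ) (n : ℕ) :
    Measurable fun z : Fin n → ℝ × ℝ => pistonLine m M V₀ (List.ofFn z) := by
  induction n with
  | zero => simp only [List.ofFn_zero]; exact measurable_const
  | succ n ih =>
    simp only [List.ofFn_succ, pistonLine]
    have hline : Measurable fun z : Fin (n + 1) → ℝ × ℝ =>
        pistonLine m M V₀ (List.ofFn fun i => z i.succ) :=
      ih.comp (measurable_pi_lambda _ fun i => measurable_pi_apply _)
    have hmeet : Measurable fun z : Fin (n + 1) → ℝ × ℝ =>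
        meetTime (pistonLine m M V₀ (List.ofFn fun i => z i.succ)) (z 0) :=
      measurable_meetTime.comp (hline.prodMk (measurable_pi_apply 0))
    unfold pistonAfter
    fun_prop

theorem volume_line_eq_zero (t y : ℝ) : volume {a : ℝ × ℝ | a.1 + a.2 * t = y} = 0 := by
  rw [Measure.volume_eq_prod, Measure.prod_apply_symm
    (measurableSet_eq_fun (by fun_prop) (by fun_prop))]
  refine (lintegral_congr fun v => ?_).trans lintegral_zero
  have hsection : (fun x => (x, v)) ⁻¹' {a : ℝ × ℝ | a.1 + a.2 * t = y} = {y - v * t} := by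
    ext x
    simp only [mem_preimage, mem_ofPred_eq, mem_singleton_iff, eq_sub_iff_add_eq]
  rw [hsection, Real.volume_singleton]

theorem pi_line_eq_zero {Λ : Measure (ℝ × ℝ)} [SigmaFinite Λ] (hΛ : Λ ≪ volume) {n : ℕ}
    {t y : (Fin n → ℝ × ℝ) → ℝ} (ht : Measurable t) (hy : Measurable y) :
    Measure.pi (fun _ : Fin (n + 1) => Λ)
      {z | (z 0).1 + (z 0).2 * t (fun i => z i.succ) = y (fun i => z i.succ)} = 0 := by
  have hmeas : MeasurableSet {q : (ℝ × ℝ) × (Fin n → ℝ × ℝ) | q.1.1 + q.1.2 * t q.2 = y q.2} :=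
    measurableSet_eq_fun (by fun_prop) (by fun_prop)
  have hsplit := (measurePreserving_piFinSuccAbove (fun _ : Fin (n + 1) => Λ) 0).measure_preimage
    hmeas.nullMeasurableSet
  rw [Measure.prod_apply_symm hmeas] at hsplit
  exact hsplit.trans ((lintegral_congr fun w => hΛ (volume_line_eq_zero (t w) (y w))).trans
    lintegral_zero)

theorem IsPoissonProcess.ae_generic {Ω : Type*} [MeasurableSpace Ω] {μ : Measure Ω}
    {Λ : Measure (ℝ × ℝ)} {S : Ω → Set (ℝ × ℝ)} [SigmaFinite Λ] (h : IsPoissonProcess μ Λ S)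
    (hΛ : Λ ≪ volume) (m M V₀ : ℝ) :
    ∀ᵐ ω ∂μ, ∀ (l : List (ℝ × ℝ)) (a c : ℝ × ℝ), (c :: a :: l).Nodup →
      (∀ x ∈ c :: a :: l, x ∈ S ω) →
      c.1 + c.2 * meetTime (pistonLine m M V₀ l) a
        ≠ a.1 + a.2 * meetTime (pistonLine m M V₀ l) a := by
  let t : ∀ n : ℕ, (Fin (n + 1) → ℝ × ℝ) → ℝ := fun n w =>
    meetTime (pistonLine m M V₀ (List.ofFn fun i => w i.succ)) (w 0)
  have ht : ∀ n, Measurable (t n) := fun n =>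
    measurable_meetTime.comp (((measurable_pistonLine_ofFn m M V₀ n).comp
      (measurable_pi_lambda _ fun i => measurable_pi_apply _)).prodMk (measurable_pi_apply 0))
  have htuple : ∀ᵐ ω ∂μ, ∀ n : ℕ, ∀ z : Fin (n + 2) → ℝ × ℝ, (∀ i, z i ∈ S ω) →
      Function.Injective z → z ∉ {z : Fin (n + 2) → ℝ × ℝ | (z 0).1
        + (z 0).2 * t n (fun i => z i.succ) = (z 1).1 + (z 1).2 * t n (fun i => z i.succ)} := by
    refine ae_all_iff.mpr fun n => h.ae_tuple_notMem
      (pi_line_eq_zero hΛ (ht n) (y := fun w => (w 0).1 + (w 0).2 * t n w) ?_)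
    have := ht n
    fun_prop
  filter_upwards [htuple] with ω hω l a c hnodup hmem heq
  have hget : (List.ofFn fun i : Fin l.length => (c :: a :: l).get i.succ.succ) = l :=
    List.ofFn_get l
  have htime : t l.length (fun i => (c :: a :: l).get i.succ) = meetTime (pistonLine m M V₀ l) a :=
    congrArg (fun l => meetTime (pistonLine m M V₀ l) a) hget
  refine hω l.length (c :: a :: l).get (fun i => hmem _ (List.get_mem (c :: a :: l) i))
    (List.nodup_iff_injective_get.mp hnodup) ?_
  change c.1 + c.2 * t l.length (fun i => (c :: a :: l).get i.succ)
    = a.1 + a.2 * t l.length (fun i => (c :: a :: l).get i.succ)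
  rw [htime]
  exact heq

/-! ### Tails of the Poisson distribution -/

theorem hasSum_poissonMeasure_exp (r : ℝ≥0) (c s : ℝ) :
    HasSum (fun n : ℕ => Real.exp (-r) * (r : ℝ) ^ n / (n.factorial : ℝ) * Real.exp (c + s * n))
      (Real.exp (c + r * (Real.exp s - 1))) := by
  have hexp := (NormedSpace.expSeries_div_hasSum_exp ((r : ℝ) * Real.exp s)).mul_left
    (Real.exp (c - r))
  rw [← Real.exp_eq_exp_ℝ, ← Real.exp_add] at hexp
  have hterm : ∀ n : ℕ, Real.exp (-r) * (r : ℝ) ^ n / (n.factorial : ℝ) * Real.exp (c + s * n)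
      = Real.exp (c - r) * (((r : ℝ) * Real.exp s) ^ n / (n.factorial : ℝ)) := fun n => by
    rw [mul_pow, ← Real.exp_nat_mul, Real.exp_add, sub_eq_add_neg, Real.exp_add, mul_comm s]
    ring
  simp_rw [hterm, show c + r * (Real.exp s - 1) = c - r + r * Real.exp s by ring]
  exact hexp

theorem poissonMeasure_le_exp (r : ℝ≥0) {s c : ℝ} {B : Set ℕ} (hB : ∀ k ∈ B, 0 ≤ c + s * k) :
    poissonMeasure r B ≤ ENNReal.ofReal (Real.exp (c + r * (Real.exp s - 1))) := by
  have hsum := hasSum_poissonMeasure_exp r c s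
  rw [← hsum.tsum_eq, ENNReal.ofReal_tsum_of_nonneg (fun n => by positivity) hsum.summable,
    poissonMeasure, Measure.sum_apply _ .of_discrete]
  refine ENNReal.tsum_le_tsum fun n => ?_
  rw [Measure.smul_apply, smul_eq_mul, ENNReal.ofReal_mul (by positivity),
    Measure.dirac_apply' _ .of_discrete]
  gcongr
  refine indicator_apply_le' (fun hn => ?_) fun _ => zero_le
  exact ENNReal.one_le_ofReal.mpr (Real.one_le_exp (hB n hn))

theorem exp_sub_one_le_add_sq {s : ℝ} (hs : |s| ≤ 1) : Real.exp s - 1 ≤ s + s ^ 2 := by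
  linarith [le_abs_self (Real.exp s - 1 - s), Real.abs_exp_sub_one_sub_id_le hs]

section Tails

variable {Ω E : Type*} [MeasurableSpace Ω] [MeasurableSpace E] {μ : Measure Ω} {Λ : Measure E}
  {S : Ω → Set E} {D : Set E}

theorem IsPoissonProcess.measure_not_countLE_le (h : IsPoissonProcess μ Λ S)
    (hD : MeasurableSet D) {L r s : ℝ} (hL : 0 ≤ L) (hΛ : Λ D ≤ ENNReal.ofReal L) (hs : 0 ≤ s) :
    μ {ω | ¬ CountLE (S ω) D r} ≤ ENNReal.ofReal (Real.exp (L * (Real.exp s - 1) - s * r)) := by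
  have hmean : ((Λ D).toNNReal : ℝ) ≤ L := ENNReal.toReal_le_of_le_ofReal hL hΛ
  refine (h.measure_encard_mem hD (ne_top_of_le_ne_top ENNReal.ofReal_ne_top hΛ)
    {e : ℕ∞ | ¬ ∃ n : ℕ, e = n ∧ (n : ℝ) ≤ r}).trans_le
    ((poissonMeasure_le_exp (c := -(s * r)) (s := s) _ fun k hk => ?_).trans ?_)
  · have hk : r < k := not_le.mp fun hkr => hk ⟨k, rfl, hkr⟩
    linarith [mul_le_mul_of_nonneg_left hk.le hs]
  · refine ENNReal.ofReal_le_ofReal (Real.exp_le_exp.mpr ?_)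
    linarith [mul_le_mul_of_nonneg_right hmean (sub_nonneg.mpr (Real.one_le_exp hs))]

theorem IsPoissonProcess.measure_not_countLE_add_le (h : IsPoissonProcess μ Λ S)
    (hD : MeasurableSet D) {L a s : ℝ} (hL : 0 ≤ L) (hΛ : Λ D ≤ ENNReal.ofReal L) (hs : 0 ≤ s)
    (hs1 : s ≤ 1) (hsa : 2 * (L * s) ≤ a) :
    μ {ω | ¬ CountLE (S ω) D (L + a)} ≤ ENNReal.ofReal (Real.exp (-(s * a / 2))) := by
  refine (h.measure_not_countLE_le hD hL hΛ hs).trans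
    (ENNReal.ofReal_le_ofReal (Real.exp_le_exp.mpr ?_))
  have hexp := exp_sub_one_le_add_sq (abs_le.mpr ⟨by linarith, hs1⟩)
  calc L * (Real.exp s - 1) - s * (L + a)
      ≤ L * (s + s ^ 2) - s * (L + a) := by gcongr
    _ = s * (2 * (L * s)) / 2 - s * a := by ring
    _ ≤ s * a / 2 - s * a := by gcongr
    _ = -(s * a / 2) := by ring

theorem IsPoissonProcess.measure_not_countGE_sub_le (h : IsPoissonProcess μ Λ S)
    (hD : MeasurableSet D) {L L' a s : ℝ} (hL' : 0 ≤ L') (hle : ENNReal.ofReal L ≤ Λ D)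
    (hge : Λ D ≤ ENNReal.ofReal L') (hs : 0 ≤ s) (hs1 : s ≤ 1) (hsa : 2 * (L' * s) ≤ a) :
    μ {ω | ¬ CountGE (S ω) D (L - a)} ≤ ENNReal.ofReal (Real.exp (-(s * a / 2))) := by
  have hfin : Λ D ≠ ∞ := ne_top_of_le_ne_top ENNReal.ofReal_ne_top hge
  set l : ℝ≥0 := (Λ D).toNNReal
  have hl : L ≤ l := (ENNReal.ofReal_le_iff_le_toReal hfin).mp hle
  have hl' : (l : ℝ) ≤ L' := ENNReal.toReal_le_of_le_ofReal hL' hge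
  refine (h.measure_encard_mem hD hfin {e : ℕ∞ | ¬ ∀ n : ℕ, e = n → L - a ≤ (n : ℝ)}).trans_le
    ((poissonMeasure_le_exp (c := s * (L - a)) (s := -s) _ fun k hk => ?_).trans
      (ENNReal.ofReal_le_ofReal (Real.exp_le_exp.mpr ?_)))
  · have hk : (k : ℝ) < L - a := not_le.mp fun hk' => hk fun n hn => Nat.cast_inj.mp hn ▸ hk'
    linarith [mul_le_mul_of_nonneg_left hk.le hs]
  · have hexp := exp_sub_one_le_add_sq (abs_neg s ▸ abs_le.mpr ⟨by linarith, hs1⟩)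
    calc s * (L - a) + l * (Real.exp (-s) - 1)
        ≤ s * (l - a) + l * (-s + (-s) ^ 2) := by gcongr
      _ = s * (2 * (l * s)) / 2 - s * a := by ring
      _ ≤ s * (2 * (L' * s)) / 2 - s * a := by gcongr
      _ ≤ s * a / 2 - s * a := by gcongr
      _ = -(s * a / 2) := by ring

/-- Two of the `N + 1` excess points account for the factor `T ^ 2`. -/
theorem IsPoissonProcess.measure_not_countLE_le_sq (h : IsPoissonProcess μ Λ S)
    (hD : MeasurableSet D) {C T : ℝ} {N : ℕ} (hC : 0 ≤ C) (hT : 0 < T) (hT1 : T ≤ 1)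
    (hΛ : Λ D ≤ ENNReal.ofReal (C * T)) (hN : 2 ≤ N) :
    μ {ω | ¬ CountLE (S ω) D N} ≤ ENNReal.ofReal (T ^ 2 * Real.exp (C * Real.exp 1 - N)) := by
  have hlog : Real.log T ≤ 0 := Real.log_nonpos hT.le hT1
  have hN' : (2 : ℝ) ≤ N := by exact_mod_cast hN
  refine (h.measure_not_countLE_le hD (by positivity) hΛ (s := 1 - Real.log T)
    (by linarith)).trans (ENNReal.ofReal_le_ofReal ?_)
  calc Real.exp (C * T * (Real.exp (1 - Real.log T) - 1) - (1 - Real.log T) * N)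
      = Real.exp (Real.log T * N + (C * Real.exp 1 - C * T) - N) := by
        rw [Real.exp_sub 1, Real.exp_log hT]
        congr 1
        field_simp
        ring
    _ ≤ Real.exp (Real.log T * 2 + (C * Real.exp 1 - N)) := by
        rw [Real.exp_le_exp]
        linarith [mul_le_mul_of_nonpos_left hN' hlog, mul_nonneg hC hT.le]
    _ = T ^ 2 * Real.exp (C * Real.exp 1 - N) := by
        rw [Real.exp_add, mul_comm (Real.log T), ← Nat.cast_ofNat (R := ℝ), Real.exp_nat_mul,
          Real.exp_log hT]

end Tails

/-! ### The intensity of the gas -/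

section Sections

variable {α β : Type*} [MeasurableSpace α] [MeasurableSpace β] {μ : Measure α} {ν : Measure β}
  [SFinite μ] [SFinite ν] {p : α × β → ℝ≥0∞} {D : Set (α × β)} {V : Set β} {g : β → ℝ≥0∞}
  {c : ℝ≥0∞}

theorem withDensity_prod_apply_symm (hp : Measurable p) (hD : MeasurableSet D) :
    (μ.prod ν).withDensity p D = ∫⁻ v, ∫⁻ x, D.indicator p (x, v) ∂μ ∂ν := by
  rw [withDensity_apply _ hD, ← lintegral_indicator hD,
    lintegral_prod_symm _ (hp.indicator hD).aemeasurable]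

theorem withDensity_prod_le (hp : Measurable p) (hD : MeasurableSet D) (hV : MeasurableSet V)
    (hc : c ≠ ∞) (hDV : ∀ z ∈ D, z.2 ∈ V) (hpg : ∀ z ∈ D, p z ≤ g z.2)
    (hsection : ∀ v ∈ V, μ ((·, v) ⁻¹' D) ≤ c) :
    (μ.prod ν).withDensity p D ≤ c * ∫⁻ v in V, g v ∂ν := by
  rw [withDensity_prod_apply_symm hp hD, ← lintegral_const_mul' _ _ hc, ← lintegral_indicator hV]
  refine lintegral_mono fun v => ?_
  by_cases hv : v ∈ V
  · rw [indicator_of_mem hv]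
    calc ∫⁻ x, D.indicator p (x, v) ∂μ
        ≤ ∫⁻ x, ((·, v) ⁻¹' D).indicator (fun _ => g v) x ∂μ :=
          lintegral_mono fun x => indicator_apply_le' (fun hx => by
            rw [indicator_of_mem (s := (·, v) ⁻¹' D) hx]; exact hpg _ hx) fun _ => zero_le
      _ = g v * μ ((·, v) ⁻¹' D) := lintegral_indicator_const (measurable_prodMk_right hD) _
      _ ≤ c * g v := by rw [mul_comm]; exact mul_le_mul_left (hsection v hv) _
  · have hzero : ∀ x, D.indicator p (x, v) = 0 := fun x => indicator_of_notMem (hv <| hDV _ ·) _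
    simp only [hzero, lintegral_zero, zero_le]

theorem le_withDensity_prod (hp : Measurable p) (hD : MeasurableSet D) (hV : MeasurableSet V)
    (hgp : ∀ z ∈ D, g z.2 ≤ p z) (hsection : ∀ v ∈ V, c ≤ μ ((·, v) ⁻¹' D)) :
    c * ∫⁻ v in V, g v ∂ν ≤ (μ.prod ν).withDensity p D := by
  rw [withDensity_prod_apply_symm hp hD, ← lintegral_indicator hV]
  refine (lintegral_const_mul_le _ _).trans (lintegral_mono fun v => ?_)
  by_cases hv : v ∈ V
  · rw [indicator_of_mem hv]
    calc c * g v ≤ g v * μ ((·, v) ⁻¹' D) := by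
          rw [mul_comm]; exact mul_le_mul_right (hsection v hv) _
      _ = ∫⁻ x, ((·, v) ⁻¹' D).indicator (fun _ => g v) x ∂μ :=
          (lintegral_indicator_const (measurable_prodMk_right hD) _).symm
      _ ≤ ∫⁻ x, D.indicator p (x, v) ∂μ :=
          lintegral_mono fun x => indicator_apply_le' (fun hx => by
            rw [indicator_of_mem (show (x, v) ∈ D from hx)]; exact hgp _ hx) fun _ => zero_le
  · simp only [indicator_of_notMem hv, mul_zero, zero_le]

end Sections

/-- The value that belongs to the gas on the side `σ = 1` (right) or `σ = -1` (left). -/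
noncomputable def ofSide {α : Type*} (left right : α) (σ : ℝ) : α := if 0 < σ then right else left

/-- The densities of the gas on both sides: positive spatial densities, and velocity densities
with the cutoffs `vmin` and `vmax`. -/
structure IsGas (vmin vmax nL nR : ℝ) (fL fR : ℝ → ℝ) : Prop where
  left_pos : 0 < nL
  right_pos : 0 < nR
  left_cutoff : IsCutoffDensity vmin vmax fL
  right_cutoff : IsCutoffDensity vmin vmax fR

section Gas

variable {vmin vmax nL nR σ u u' lo hi t₀ t₁ : ℝ} {f fL fR : ℝ → ℝ}

theorem IsGas.ofSide_pos (hG : IsGas vmin vmax nL nR fL fR) (σ : ℝ) : 0 < ofSide nL nR σ := by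
  unfold ofSide; split_ifs <;> [exact hG.right_pos; exact hG.left_pos]

theorem IsGas.ofSide_cutoff (hG : IsGas vmin vmax nL nR fL fR) (σ : ℝ) :
    IsCutoffDensity vmin vmax (ofSide fL fR σ) := by
  unfold ofSide; split_ifs <;> [exact hG.right_cutoff; exact hG.left_cutoff]

theorem gasDensity_of_side (hσ : |σ| = 1) {z : ℝ × ℝ} (hz : 0 < σ * z.1) :
    gasDensity nL nR fL fR z = ofSide nL nR σ * ofSide fL fR σ z.2 := by
  rcases eq_or_eq_neg_of_abs_eq hσ with rfl | rfl
  · simp [gasDensity, ofSide, (one_mul z.1 ▸ hz : 0 < z.1)]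
  · have hz' : z.1 < 0 := by linarith
    simp [gasDensity, ofSide, hz', hz'.not_gt, (by norm_num : ¬ (0 : ℝ) < -1)]

theorem IsGas.measurable_ofReal_gasDensity (hG : IsGas vmin vmax nL nR fL fR) :
    Measurable fun z => ENNReal.ofReal (gasDensity nL nR fL fR z) := by
  have hL := hG.left_cutoff.measurable
  have hR := hG.right_cutoff.measurable
  exact (Measurable.ite (measurableSet_lt measurable_const measurable_fst) (by fun_prop)
    (.ite (measurableSet_lt measurable_fst measurable_const) (by fun_prop)
      measurable_const)).ennreal_ofReal

instance : SigmaFinite (gasIntensity nL nR fL fR) := by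
  unfold gasIntensity; infer_instance

theorem measurableSet_crossing (σ lo hi t₀ t₁ u u' : ℝ) :
    MeasurableSet (crossing σ lo hi t₀ t₁ u u') := by
  unfold crossing
  measurability

theorem measurableSet_nearby (p r t : ℝ) : MeasurableSet (nearby p r t) :=
  measurableSet_le (by fun_prop) measurable_const

theorem IsCutoffDensity.lintegral_towards (hf : IsCutoffDensity vmin vmax f) {n : ℝ} (hn : 0 ≤ n)
    (hσ : |σ| = 1) (hu : u ≤ u') :
    ∫⁻ v in {v | u ≤ -(σ * v) ∧ -(σ * v) < u'}, ENNReal.ofReal (n * f v)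
      = ENNReal.ofReal (n * ∫ v in u..u', f v) := by
  have hIco : ∫⁻ v in Ico u u', ENNReal.ofReal (n * f v)
      = ENNReal.ofReal (n * ∫ v in u..u', f v) := by
    rw [← intervalIntegral.integral_const_mul, intervalIntegral.integral_of_le hu,
      ← ofReal_integral_eq_lintegral_ofReal ((hf.integrable.const_mul n).integrableOn)
        (.of_forall fun v => mul_nonneg hn (hf.nonneg v)),
      integral_Ico_eq_integral_Ioo, integral_Ioc_eq_integral_Ioo]
  rw [← hIco]
  rcases eq_or_eq_neg_of_abs_eq hσ with rfl | rfl
  · rw [← lintegral_indicator measurableSet_Ico, ← lintegral_indicator (by measurability)]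
    refine (lintegral_congr fun v => ?_).trans (lintegral_neg_eq_self ..)
    simp only [indicator, mem_ofPred_eq, mem_Ico, one_mul, hf.symm]
  · simp only [neg_one_mul, neg_neg]
    rfl

theorem volume_preimage_side_mul_Ioc (hσ : |σ| = 1) (a b : ℝ) :
    volume ((σ * ·) ⁻¹' Ioc a b) = ENNReal.ofReal (b - a) := by
  rw [Real.volume_preimage_mul_left (abs_ne_zero.mp (hσ ▸ one_ne_zero)), abs_inv, hσ, inv_one,
    ENNReal.ofReal_one, one_mul, Real.volume_Ioc]

theorem IsGas.intensity_crossing_le (hG : IsGas vmin vmax nL nR fL fR) (hσ : |σ| = 1)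
    (ht : t₀ ≤ t₁) (hu : u ≤ u') :
    gasIntensity nL nR fL fR (crossing σ lo hi t₀ t₁ u u')
      ≤ ENNReal.ofReal (ofSide nL nR σ * (∫ v in u..u', ofSide fL fR σ v)
          * (u' * (t₁ - t₀) + (hi - lo))) := by
  have hf := hG.ofSide_cutoff σ
  have hn := (hG.ofSide_pos σ).le
  have hmass : 0 ≤ ∫ v in u..u', ofSide fL fR σ v :=
    intervalIntegral.integral_nonneg hu fun v _ => hf.nonneg v
  rw [ENNReal.ofReal_mul (mul_nonneg hn hmass), ← hf.lintegral_towards hn hσ hu, mul_comm]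
  refine withDensity_prod_le hG.measurable_ofReal_gasDensity (measurableSet_crossing ..)
    (by measurability) ENNReal.ofReal_ne_top (fun z hz => ⟨hz.2.1, hz.2.2.1⟩)
    (fun z hz => by rw [gasDensity_of_side hσ hz.1]) fun v hv => ?_
  calc volume ((·, v) ⁻¹' crossing σ lo hi t₀ t₁ u u')
      ≤ volume ((σ * ·) ⁻¹' Ioc (lo - σ * v * t₀) (hi - σ * v * t₁)) :=
        measure_mono fun x ⟨_, _, _, hlo, hhi⟩ =>
          ⟨sub_lt_iff_lt_add.mpr hlo, le_sub_iff_add_le.mpr hhi⟩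
    _ = ENNReal.ofReal (-(σ * v) * (t₁ - t₀) + (hi - lo)) := by
        rw [volume_preimage_side_mul_Ioc hσ]; congr 1; ring
    _ ≤ ENNReal.ofReal (u' * (t₁ - t₀) + (hi - lo)) := by
        gcongr
        exact hv.2.le

theorem IsGas.le_intensity_crossing (hG : IsGas vmin vmax nL nR fL fR) (hσ : |σ| = 1)
    (ht₀ : 0 ≤ t₀) (ht : t₀ ≤ t₁) (hu : u ≤ u') (hlo : 0 ≤ lo + u * t₀) :
    ENNReal.ofReal (ofSide nL nR σ * (∫ v in u..u', ofSide fL fR σ v)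
        * (u * (t₁ - t₀) + (hi - lo)))
      ≤ gasIntensity nL nR fL fR (crossing σ lo hi t₀ t₁ u u') := by
  have hf := hG.ofSide_cutoff σ
  have hn := (hG.ofSide_pos σ).le
  have hmass : 0 ≤ ∫ v in u..u', ofSide fL fR σ v :=
    intervalIntegral.integral_nonneg hu fun v _ => hf.nonneg v
  rw [ENNReal.ofReal_mul (mul_nonneg hn hmass), ← hf.lintegral_towards hn hσ hu, mul_comm]
  refine le_withDensity_prod hG.measurable_ofReal_gasDensity (measurableSet_crossing ..)
    (by measurability) (fun z hz => by rw [gasDensity_of_side hσ hz.1]) fun v hv => ?_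
  calc ENNReal.ofReal (u * (t₁ - t₀) + (hi - lo))
      ≤ ENNReal.ofReal (-(σ * v) * (t₁ - t₀) + (hi - lo)) := by
        gcongr
        exact hv.1
    _ = volume ((σ * ·) ⁻¹' Ioc (lo - σ * v * t₀) (hi - σ * v * t₁)) := by
        rw [volume_preimage_side_mul_Ioc hσ]; congr 1; ring
    _ ≤ volume ((·, v) ⁻¹' crossing σ lo hi t₀ t₁ u u') := measure_mono fun x ⟨hxlo, hxhi⟩ =>
        ⟨by linarith [mul_le_mul_of_nonneg_right hv.1 ht₀], hv.1, hv.2,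
          sub_lt_iff_lt_add.mp hxlo, le_sub_iff_add_le.mp hxhi⟩

theorem IsGas.gasDensity_le_add (hG : IsGas vmin vmax nL nR fL fR) (z : ℝ × ℝ) :
    gasDensity nL nR fL fR z ≤ nL * fL z.2 + nR * fR z.2 := by
  have hL := mul_nonneg hG.left_pos.le (hG.left_cutoff.nonneg z.2)
  have hR := mul_nonneg hG.right_pos.le (hG.right_cutoff.nonneg z.2)
  unfold gasDensity
  split_ifs <;> linarith

theorem IsGas.intensity_nearby_le (hG : IsGas vmin vmax nL nR fL fR) (p r t : ℝ) :
    gasIntensity nL nR fL fR (nearby p r t) ≤ ENNReal.ofReal ((nL + nR) * (2 * r)) := by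
  have hL := hG.left_cutoff
  have hR := hG.right_cutoff
  have hsum_int : Integrable fun v => nL * fL v + nR * fR v :=
    (hL.integrable.const_mul nL).add (hR.integrable.const_mul nR)
  have htotal : ∫⁻ v in univ, ENNReal.ofReal (nL * fL v + nR * fR v)
      = ENNReal.ofReal (nL + nR) := by
    rw [setLIntegral_univ, ← ofReal_integral_eq_lintegral_ofReal hsum_int
      (.of_forall fun v => add_nonneg (mul_nonneg hG.left_pos.le (hL.nonneg v))
        (mul_nonneg hG.right_pos.le (hR.nonneg v))),
      integral_add (hL.integrable.const_mul nL) (hR.integrable.const_mul nR),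
      integral_const_mul, integral_const_mul, hL.integral_eq_one, hR.integral_eq_one, mul_one,
      mul_one]
  rw [ENNReal.ofReal_mul (add_pos hG.left_pos hG.right_pos).le, ← htotal, mul_comm]
  refine withDensity_prod_le hG.measurable_ofReal_gasDensity (measurableSet_nearby p r t) .univ
    ENNReal.ofReal_ne_top (fun _ _ => mem_univ _)
    (fun z _ => ENNReal.ofReal_le_ofReal (hG.gasDensity_le_add z)) fun v _ => ?_
  have hsection : (·, v) ⁻¹' nearby p r t = Metric.closedBall (p - v * t) r := by
    ext x
    simp only [nearby, mem_preimage, mem_ofPred_eq, Metric.mem_closedBall, Real.dist_eq]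
    congr! 2
    ring
  rw [hsection, Real.volume_closedBall]

theorem IsGas.intensity_irregular (hG : IsGas vmin vmax nL nR fL fR) :
    gasIntensity nL nR fL fR {a | a.1 = 0 ∨ |a.2| ≤ vmin ∨ vmax ≤ |a.2|} = 0 := by
  rw [gasIntensity, withDensity_apply_eq_zero hG.measurable_ofReal_gasDensity]
  convert measure_empty (μ := (volume : Measure (ℝ × ℝ)))
  refine eq_empty_iff_forall_notMem.mpr fun z ⟨hne, hz⟩ => hne ?_
  rcases hz with hz | hz
  · simp [gasDensity, hz]
  · simp [gasDensity, hG.left_cutoff.cutoff _ hz, hG.right_cutoff.cutoff _ hz]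

theorem IsPoissonProcess.ae_regularGas (hG : IsGas vmin vmax nL nR fL fR) {Ω : Type*}
    [MeasurableSpace Ω] {μ : Measure Ω} {S : Ω → Set (ℝ × ℝ)}
    (h : IsPoissonProcess μ (gasIntensity nL nR fL fR) S) (m M V₀ : ℝ) :
    ∀ᵐ ω ∂μ, RegularGas m M V₀ vmin vmax (S ω) := by
  have hfinite : ∀ᵐ ω ∂μ, ∀ n : ℕ, (S ω ∩ nearby 0 n 0).Finite := ae_all_iff.mpr fun n =>
    h.ae_finite_inter (measurableSet_nearby _ _ _)
      (ne_top_of_le_ne_top ENNReal.ofReal_ne_top (hG.intensity_nearby_le 0 n 0))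
  have hmeas : MeasurableSet {a : ℝ × ℝ | a.1 = 0 ∨ |a.2| ≤ vmin ∨ vmax ≤ |a.2|} :=
    (measurableSet_eq_fun measurable_fst measurable_const).union
      ((measurableSet_le measurable_snd.abs measurable_const).union
        (measurableSet_le measurable_const measurable_snd.abs))
  filter_upwards [hfinite, h.ae_inter_eq_empty hmeas hG.intensity_irregular,
    h.ae_generic (withDensity_absolutelyContinuous _ _) m M V₀] with ω hfin hirregular hgeneric
  have hregular : ∀ a ∈ S ω, ¬ (a.1 = 0 ∨ |a.2| ≤ vmin ∨ vmax ≤ |a.2|) := fun a ha h' =>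
    (eq_empty_iff_forall_notMem.mp hirregular) a ⟨ha, h'⟩
  simp only [not_or, not_le] at hregular
  refine ⟨fun a ha => (hregular a ha).1, fun a ha => (hregular a ha).2.1,
    fun a ha => (hregular a ha).2.2, fun r => ?_, hgeneric⟩
  obtain ⟨n, hn⟩ := exists_nat_ge r
  refine (hfin n).subset (inter_subset_inter_right _ fun a (ha : |a.1| ≤ r) => ?_)
  simpa [nearby] using ha.trans hn

end Gas

/-! ### The balance of the bins -/

/-- The mass that the density `f` gives to the `i`-th bin of speeds. -/
noncomputable def binMass (f : ℝ → ℝ) (vmin δ : ℝ) (i : ℕ) : ℝ :=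
  ∫ v in binEdge vmin δ i..binEdge vmin δ (i + 1), f v

section BinMass

variable {vmin vmax δ : ℝ} {f : ℝ → ℝ} {K : ℕ}

theorem binMass_nonneg (hf : IsCutoffDensity vmin vmax f) (hδ : 0 ≤ δ) (i : ℕ) :
    0 ≤ binMass f vmin δ i :=
  intervalIntegral.integral_nonneg (by rw [binEdge_succ]; linarith) fun v _ => hf.nonneg v

theorem IsCutoffDensity.setIntegral_Ioi_eq_sum_bins (hf : IsCutoffDensity vmin vmax f)
    (hvmin : 0 < vmin) (hδ : 0 ≤ δ) (hK : binEdge vmin δ K = vmax) {w : ℝ → ℝ}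
    (hw : Continuous w) :
    ∫ v in Ioi 0, w v * f v = ∑ i ∈ Finset.range K,
      ∫ v in binEdge vmin δ i..binEdge vmin δ (i + 1), w v * f v := by
  rw [intervalIntegral.sum_integral_adjacent_intervals fun k _ =>
      hf.integrable.intervalIntegrable.continuousOn_mul hw.continuousOn, hK,
    show binEdge vmin δ 0 = vmin by simp [binEdge],
    intervalIntegral.integral_of_le (hK ▸ le_binEdge hδ K)]
  refine setIntegral_eq_of_subset_of_forall_sdiff_eq_zero measurableSet_Ioi
    (fun v hv => hvmin.trans hv.1) fun v ⟨hv0, hv⟩ => ?_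
  have hcut : |v| ≤ vmin ∨ vmax ≤ |v| := by
    rw [abs_of_pos hv0]
    by_contra! h
    exact hv ⟨h.1, h.2.le⟩
  rw [hf.cutoff v hcut, mul_zero]

theorem sum_binMass (hf : IsCutoffDensity vmin vmax f) (hvmin : 0 < vmin)
    (hδ : 0 ≤ δ) (hK : binEdge vmin δ K = vmax) :
    ∑ i ∈ Finset.range K, binMass f vmin δ i = 1 / 2 := by
  have hbins := hf.setIntegral_Ioi_eq_sum_bins hvmin hδ hK (w := fun _ => 1) continuous_const
  simp only [one_mul] at hbins
  have heven : ∀ v, f |v| = f v := fun v => by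
    rcases abs_choice v with h | h <;> rw [h]
    exact hf.symm v
  have htotal := integral_comp_abs (f := f)
  simp only [heven, hf.integral_eq_one] at htotal
  simp only [binMass, ← hbins]
  linarith

theorem binMass_le_half (hf : IsCutoffDensity vmin vmax f) (hvmin : 0 < vmin) (hδ : 0 ≤ δ)
    (hK : binEdge vmin δ K = vmax) {i : ℕ} (hi : i < K) : binMass f vmin δ i ≤ 1 / 2 := by
  rw [← sum_binMass hf hvmin hδ hK]
  exact Finset.single_le_sum (fun i _ => binMass_nonneg hf hδ i) (Finset.mem_range.mpr hi)

theorem sum_binMass_mul_sq_le (hf : IsCutoffDensity vmin vmax f) (hvmin : 0 < vmin)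
    (hδ : 0 ≤ δ) (hK : binEdge vmin δ K = vmax) :
    ∑ i ∈ Finset.range K, binMass f vmin δ i * binEdge vmin δ i ^ 2
      ≤ ∫ v in Ioi 0, v ^ 2 * f v := by
  rw [hf.setIntegral_Ioi_eq_sum_bins hvmin hδ hK (continuous_pow 2)]
  refine Finset.sum_le_sum fun i _ => ?_
  rw [mul_comm, binMass, ← intervalIntegral.integral_const_mul]
  refine intervalIntegral.integral_mono_on (by rw [binEdge_succ]; linarith)
    (hf.integrable.intervalIntegrable.const_mul _)
    (hf.integrable.intervalIntegrable.continuousOn_mul (continuous_pow 2).continuousOn)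
    fun v hv => mul_le_mul_of_nonneg_right ?_ (hf.nonneg v)
  exact pow_le_pow_left₀ (hvmin.le.trans (le_binEdge hδ i)) hv.1 2

theorem le_sum_binMass_mul_sq (hf : IsCutoffDensity vmin vmax f) (hvmin : 0 < vmin)
    (hδ : 0 ≤ δ) (hK : binEdge vmin δ K = vmax) :
    ∫ v in Ioi 0, v ^ 2 * f v
      ≤ ∑ i ∈ Finset.range K, binMass f vmin δ i * binEdge vmin δ (i + 1) ^ 2 := by
  rw [hf.setIntegral_Ioi_eq_sum_bins hvmin hδ hK (continuous_pow 2)]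
  refine Finset.sum_le_sum fun i _ => ?_
  rw [mul_comm (binMass ..), binMass, ← intervalIntegral.integral_const_mul]
  refine intervalIntegral.integral_mono_on (by rw [binEdge_succ]; linarith)
    (hf.integrable.intervalIntegrable.continuousOn_mul (continuous_pow 2).continuousOn)
    (hf.integrable.intervalIntegrable.const_mul _)
    fun v hv => mul_le_mul_of_nonneg_right ?_ (hf.nonneg v)
  exact pow_le_pow_left₀ (hvmin.le.trans ((le_binEdge hδ i).trans hv.1)) hv.2 2

end BinMass

section Balance

variable {vmin vmax c δ η u p τ n n' : ℝ} {K : ℕ} {P Q : ℕ → ℝ} {f f' : ℝ → ℝ}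

theorem push_le (hη : 0 ≤ η) (hvmin : 0 ≤ vmin) (hc : 0 ≤ c) (hδ : 0 ≤ δ) (hp : 0 ≤ p)
    (hu : vmin ≤ u) (hu' : u + δ ≤ vmax) (hfine : 4 * vmax * (δ + η) ≤ c * vmin) :
    (u + δ - c) * (p * (u + δ + η) + η) ≤ p * u ^ 2 - p * (c * vmin / 2) + vmax * η := by
  have hsq : (u + δ - c) * (u + δ + η) ≤ u ^ 2 - c * vmin / 2 := by
    nlinarith [mul_nonneg hδ (by linarith : 0 ≤ vmax - u - δ), mul_nonneg hδ hδ,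
      mul_nonneg hη (by linarith : 0 ≤ vmax - u - δ), mul_nonneg hc hη, mul_nonneg hc hδ,
      mul_nonneg hc (by linarith : 0 ≤ u - vmin), mul_nonneg hδ hvmin, mul_nonneg hη hvmin]
  linarith [mul_le_mul_of_nonneg_left hsq hp,
    mul_nonneg hη (by linarith : 0 ≤ vmax - (u + δ - c))]

theorem le_brake (hη : 0 ≤ η) (hvmin : 0 ≤ vmin) (hc : 0 ≤ c) (hcv : c ≤ vmin) (hδ : 0 ≤ δ)
    (hp : 0 ≤ p) (hu : vmin ≤ u) (hu' : u + δ ≤ vmax) (hfine : 4 * vmax * (δ + η) ≤ c * vmin) :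
    p * (u + δ) ^ 2 - 2 * vmax * η ≤ (u + c) * (p * (u - η) - η) := by
  have hsq : (u + δ) ^ 2 ≤ (u + c) * (u - η) := by
    nlinarith [mul_nonneg hδ (by linarith : 0 ≤ vmax - u - δ), mul_nonneg hδ hδ,
      mul_nonneg hη (by linarith : 0 ≤ vmax - u - δ), mul_nonneg hη (by linarith : 0 ≤ vmin - c),
      mul_nonneg hc (by linarith : 0 ≤ u - vmin), mul_nonneg hδ hvmin, mul_nonneg hη hvmin]
  linarith [mul_le_mul_of_nonneg_left hsq hp,
    mul_nonneg hη (by linarith : 0 ≤ 2 * vmax - (u + c))]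

/-- The bins of width `δ` cut `[vmin, vmax]` into `K` parts, and they and the tolerance `η` are so
fine that in a gas of density `n` the errors of the counts are small against the momentum by which
a piston of velocity `c` is slowed down. -/
structure FineBins (vmin vmax c n δ η : ℝ) (K : ℕ) : Prop where
  width_pos : 0 < δ
  tol_pos : 0 < η
  last_edge : binEdge vmin δ K = vmax
  fine : 4 * vmax * (δ + η) ≤ c * vmin
  tol_le : 12 * vmax * K * η ≤ n * (c * vmin)

theorem FineBins.mono (hB : FineBins vmin vmax c n δ η K) (hn : n ≤ n') (hc : 0 ≤ c)
    (hvmin : 0 ≤ vmin) : FineBins vmin vmax c n' δ η K :=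
  { hB with tol_le := hB.tol_le.trans (by gcongr) }

theorem exists_fineBins (hvmin : 0 < vmin) (hv : vmin < vmax) (hc : 0 < c)
    (hn : 0 < n) : ∃ δ η, ∃ K : ℕ, FineBins vmin vmax c n δ η K := by
  have hvmax := hvmin.trans hv
  have hwidth := sub_pos.mpr hv
  set D := c * vmin / (8 * vmax)
  have hD : 0 < D := by positivity
  obtain ⟨K, hK⟩ := exists_nat_gt ((vmax - vmin) / D)
  have hK0 : (0 : ℝ) < K := (div_pos hwidth hD).trans hK
  refine ⟨(vmax - vmin) / K, min D (n * (c * vmin) / (12 * vmax * K)), K, by positivity,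
    by positivity, by rw [binEdge, mul_div_cancel₀ _ hK0.ne']; ring, ?_, ?_⟩
  · calc _ ≤ 4 * vmax * (D + D) := by
          gcongr
          · exact (div_lt_comm₀ hD hK0).mp hK |>.le
          · exact min_le_left ..
      _ = c * vmin := by simp only [D]; field_simp; ring
  · calc _ ≤ 12 * vmax * K * (n * (c * vmin) / (12 * vmax * K)) := by
          gcongr; exact min_le_right ..
      _ = n * (c * vmin) := mul_div_cancel₀ _ (by positivity)

theorem sum_push_le_sum_brake (hvmin : 0 < vmin) (hc : 0 < c) (hcv : c ≤ vmin)
    (hB : FineBins vmin vmax c (2 * ∑ i ∈ Finset.range K, P i) δ η K)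
    (hP : ∀ i, 0 ≤ P i) (hQ : ∀ i, 0 ≤ Q i)
    (hPQ : ∑ i ∈ Finset.range K, P i * binEdge vmin δ i ^ 2
      ≤ ∑ i ∈ Finset.range K, Q i * binEdge vmin δ (i + 1) ^ 2) :
    ∑ i ∈ Finset.range K,
        (binEdge vmin δ (i + 1) - c) * (P i * (binEdge vmin δ (i + 1) + η) + η)
      ≤ ∑ i ∈ Finset.range K, (binEdge vmin δ i + c) * (Q i * (binEdge vmin δ i - η) - η) := by
  have hδ := hB.width_pos.le
  have hη := hB.tol_pos.le
  have hlast : ∀ i ∈ Finset.range K, binEdge vmin δ i + δ ≤ vmax := fun i hi => by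
    rw [← binEdge_succ, ← hB.last_edge]
    exact binEdge_succ_le hδ (Finset.mem_range.mp hi)
  calc _ ≤ ∑ i ∈ Finset.range K,
          (P i * binEdge vmin δ i ^ 2 - P i * (c * vmin / 2) + vmax * η) :=
        Finset.sum_le_sum fun i hi => by
          rw [binEdge_succ]
          exact push_le hη hvmin.le hc.le hδ (hP i) (le_binEdge hδ i) (hlast i hi) hB.fine
    _ ≤ ∑ i ∈ Finset.range K, (Q i * binEdge vmin δ (i + 1) ^ 2 - 2 * vmax * η) := by
        simp only [Finset.sum_add_distrib, Finset.sum_sub_distrib, Finset.sum_const,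
          Finset.card_range, nsmul_eq_mul, ← Finset.sum_mul]
        linarith [hB.tol_le]
    _ ≤ _ := Finset.sum_le_sum fun i hi => by
          rw [binEdge_succ]
          exact le_brake hη hvmin.le hc.le hcv hδ (hQ i) (le_binEdge hδ i) (hlast i hi) hB.fine

/-- The number of atoms in the `i`-th bin of a gas of density `n * f` that hit the piston in a
window of length `τ`, estimated from above with the tolerance `η`. -/
noncomputable def upperCount (n : ℝ) (f : ℝ → ℝ) (vmin δ η τ : ℝ) (i : ℕ) : ℝ :=
  τ * (n * binMass f vmin δ i * (binEdge vmin δ (i + 1) + η) + η)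

/-- The number of atoms in the `i`-th bin of a gas of density `n * f` that hit the piston in a
window of length `τ`, estimated from below with the tolerance `η`. -/
noncomputable def lowerCount (n : ℝ) (f : ℝ → ℝ) (vmin δ η τ : ℝ) (i : ℕ) : ℝ :=
  τ * (n * binMass f vmin δ i * (binEdge vmin δ i - η) - η)

theorem sum_upperCount_le_sum_lowerCount (hf : IsCutoffDensity vmin vmax f)
    (hf' : IsCutoffDensity vmin vmax f') (hvmin : 0 < vmin) (hc : 0 < c) (hcv : c ≤ vmin)
    (hτ : 0 ≤ τ) (hn : 0 ≤ n) (hn' : 0 ≤ n')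
    (hbal : n * ∫ v in Ioi (0 : ℝ), v ^ 2 * f v = n' * ∫ v in Ioi (0 : ℝ), v ^ 2 * f' v)
    (hB : FineBins vmin vmax c n δ η K) :
    ∑ i ∈ Finset.range K, (binEdge vmin δ (i + 1) - c) * upperCount n f vmin δ η τ i
      ≤ ∑ i ∈ Finset.range K, (binEdge vmin δ i + c) * lowerCount n' f' vmin δ η τ i := by
  have hδ := hB.width_pos.le
  have hpressure : ∑ i ∈ Finset.range K, n * binMass f vmin δ i * binEdge vmin δ i ^ 2
      ≤ ∑ i ∈ Finset.range K, n' * binMass f' vmin δ i * binEdge vmin δ (i + 1) ^ 2 := by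
    simp only [mul_assoc, ← Finset.mul_sum]
    calc _ ≤ n * ∫ v in Ioi (0 : ℝ), v ^ 2 * f v := by
          gcongr; exact sum_binMass_mul_sq_le hf hvmin hδ hB.last_edge
      _ ≤ _ := by
          rw [hbal]; gcongr; exact le_sum_binMass_mul_sq hf' hvmin hδ hB.last_edge
  have htotal : 2 * ∑ i ∈ Finset.range K, n * binMass f vmin δ i = n := by
    rw [← Finset.mul_sum, sum_binMass hf hvmin hδ hB.last_edge]; ring
  have hmomentum := sum_push_le_sum_brake hvmin hc hcv (htotal.symm ▸ hB)
    (fun i => mul_nonneg hn (binMass_nonneg hf hδ i))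
    (fun i => mul_nonneg hn' (binMass_nonneg hf' hδ i)) hpressure
  simpa only [upperCount, lowerCount, mul_left_comm _ τ, ← Finset.mul_sum]
    using mul_le_mul_of_nonneg_left hmomentum hτ

end Balance

/-! ### Atypical counts are improbable -/

section UnionBound

variable {Ω ι : Type*} [MeasurableSpace Ω] {μ : Measure Ω}

theorem measure_not_le_of_imp {P Q : Ω → Prop} (h : ∀ ω, P ω → Q ω) :
    μ {ω | ¬ Q ω} ≤ μ {ω | ¬ P ω} :=
  measure_mono fun ω hω hP => hω (h ω hP)

theorem measure_not_and_le (P Q : Ω → Prop) :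
    μ {ω | ¬ (P ω ∧ Q ω)} ≤ μ {ω | ¬ P ω} + μ {ω | ¬ Q ω} :=
  (measure_mono fun _ hω => not_and_or.mp hω).trans (measure_union_le _ _)

theorem measure_not_forall_mem_le {s : Finset ι} {P : ι → Ω → Prop} {q : ℝ≥0∞}
    (h : ∀ i ∈ s, μ {ω | ¬ P i ω} ≤ q) : μ {ω | ¬ ∀ i ∈ s, P i ω} ≤ s.card * q :=
  calc μ {ω | ¬ ∀ i ∈ s, P i ω} ≤ μ (⋃ i ∈ s, {ω | ¬ P i ω}) := measure_mono fun ω hω => by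
        simpa using hω
    _ ≤ ∑ _i ∈ s, q := (measure_biUnion_finset_le _ _).trans (Finset.sum_le_sum h)
    _ = s.card * q := by rw [Finset.sum_const, nsmul_eq_mul]

end UnionBound

/-- A bound for the number of atoms per unit of time that can reach a piston in a cell of length
`η * τ` during a window of length `τ`. -/
noncomputable def gasRate (nL nR vmax η : ℝ) : ℝ := (nL + nR) * (4 * vmax + η)

/-- For a piston that is at `x` at the time `t`, the counts of atoms in the following window of
length `τ` deviate from their means by at most the tolerance `η`. -/
def TypicalAt (nL nR : ℝ) (fL fR : ℝ → ℝ) (vmin vmax δ η τ : ℝ) (K : ℕ) (A : Set (ℝ × ℝ))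
    (t x : ℝ) : Prop :=
  TypicalCounts A vmin vmax δ τ ((gasRate nL nR vmax η + η) * τ) K
    (fun σ => upperCount (ofSide nL nR σ) (ofSide fL fR σ) vmin δ η τ)
    (fun σ => lowerCount (ofSide nL nR σ) (ofSide fL fR σ) vmin δ η τ) t x

section Improbable

variable {vmin vmax nL nR σ δ η τ s p t : ℝ} {fL fR : ℝ → ℝ} {K i : ℕ} {Ω : Type*}
  [MeasurableSpace Ω] {μ : Measure Ω} {S : Ω → Set (ℝ × ℝ)}

theorem IsGas.mass_mul_le_gasRate (hG : IsGas vmin vmax nL nR fL fR) (hvmin : 0 < vmin)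
    (hδ : 0 ≤ δ) (hη : 0 ≤ η) (hK : binEdge vmin δ K = vmax) (hi : i < K) (σ : ℝ) :
    ofSide nL nR σ * binMass (ofSide fL fR σ) vmin δ i * (binEdge vmin δ (i + 1) + η)
      ≤ gasRate nL nR vmax η := by
  have hn : ofSide nL nR σ ≤ nL + nR := by
    unfold ofSide; split_ifs <;> linarith [hG.left_pos, hG.right_pos]
  have hedge : binEdge vmin δ (i + 1) ≤ vmax := hK ▸ binEdge_succ_le hδ hi
  have hedge' := hvmin.le.trans (le_binEdge (vmin := vmin) hδ (i + 1))
  have hmass : binMass (ofSide fL fR σ) vmin δ i ≤ 1 :=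
    (binMass_le_half (hG.ofSide_cutoff σ) hvmin hδ hK hi).trans (by norm_num)
  calc _ ≤ (nL + nR) * 1 * (4 * vmax + η) := by
        have := binMass_nonneg (hG.ofSide_cutoff σ) hδ i
        have := (hG.ofSide_pos σ).le.trans hn
        gcongr
        linarith
    _ = gasRate nL nR vmax η := by rw [mul_one, gasRate]

theorem IsPoissonProcess.measure_not_countLE_crossing_le
    (h : IsPoissonProcess μ (gasIntensity nL nR fL fR) S) (hG : IsGas vmin vmax nL nR fL fR)
    (hvmin : 0 < vmin) (hδ : 0 ≤ δ) (hη : 0 ≤ η) (hτ : 0 ≤ τ) (hK : binEdge vmin δ K = vmax)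
    (hs : 0 ≤ s) (hs1 : s ≤ 1) (hsη : 2 * (gasRate nL nR vmax η * s) ≤ η) (hσ : |σ| = 1)
    (hi : i < K) :
    μ {ω | ¬ CountLE (S ω) (crossing σ (σ * p - η * τ / 2) (σ * p + η * τ / 2) t (t + τ)
        (binEdge vmin δ i) (binEdge vmin δ (i + 1)))
        (upperCount (ofSide nL nR σ) (ofSide fL fR σ) vmin δ η τ i)}
      ≤ ENNReal.ofReal (Real.exp (-(s * (η * τ) / 2))) := by
  have hmean := hG.intensity_crossing_le (lo := σ * p - η * τ / 2) (hi := σ * p + η * τ / 2)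
    (t₀ := t) (t₁ := t + τ) (u := binEdge vmin δ i) (u' := binEdge vmin δ (i + 1)) hσ
    (by linarith) (by rw [binEdge_succ]; linarith)
  have hrate := hG.mass_mul_le_gasRate hvmin hδ hη hK hi σ
  have hmass := mul_nonneg (hG.ofSide_pos σ).le (binMass_nonneg (hG.ofSide_cutoff σ) hδ i)
  have hedge := hvmin.le.trans (le_binEdge (vmin := vmin) hδ (i + 1))
  rw [← binMass, show binEdge vmin δ (i + 1) * (t + τ - t)
    + (σ * p + η * τ / 2 - (σ * p - η * τ / 2)) = (binEdge vmin δ (i + 1) + η) * τ by ring,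
    ← mul_assoc] at hmean
  convert h.measure_not_countLE_add_le (a := η * τ) (measurableSet_crossing ..) (by positivity)
    hmean hs hs1 ?_ using 3
  · rw [upperCount]; ring_nf
  · linarith [mul_le_mul_of_nonneg_right (mul_le_mul_of_nonneg_right hrate hτ) hs,
      mul_le_mul_of_nonneg_right hsη hτ]

theorem IsPoissonProcess.measure_not_countGE_crossing_le
    (h : IsPoissonProcess μ (gasIntensity nL nR fL fR) S) (hG : IsGas vmin vmax nL nR fL fR)
    (hvmin : 0 < vmin) (hδ : 0 ≤ δ) (hη : 0 ≤ η) (hτ : 0 ≤ τ) (hK : binEdge vmin δ K = vmax)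
    (hs : 0 ≤ s) (hs1 : s ≤ 1) (hsη : 2 * (gasRate nL nR vmax η * s) ≤ η) (hσ : |σ| = 1)
    (hi : i < K) (ht : 0 ≤ t) (hp : |p| ≤ vmin * t + η * τ / 2) :
    μ {ω | ¬ CountGE (S ω) (crossing σ (σ * p + η * τ / 2) (σ * p - η * τ / 2) t (t + τ)
        (binEdge vmin δ i) (binEdge vmin δ (i + 1)))
        (lowerCount (ofSide nL nR σ) (ofSide fL fR σ) vmin δ η τ i)}
      ≤ ENNReal.ofReal (Real.exp (-(s * (η * τ) / 2))) := by
  have hp' : 0 ≤ σ * p + η * τ / 2 + binEdge vmin δ i * t := by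
    have hσp := neg_abs_le (σ * p)
    rw [abs_mul, hσ, one_mul] at hσp
    linarith [mul_le_mul_of_nonneg_right (le_binEdge (vmin := vmin) hδ i) ht]
  have hedges : binEdge vmin δ i ≤ binEdge vmin δ (i + 1) := by rw [binEdge_succ]; linarith
  have hmean := hG.le_intensity_crossing (hi := σ * p - η * τ / 2) (t₁ := t + τ) hσ ht
    (by linarith) hedges hp'
  have hmean' := hG.intensity_crossing_le (lo := σ * p + η * τ / 2) (hi := σ * p - η * τ / 2)
    (t₀ := t) (t₁ := t + τ) hσ (by linarith) hedges
  have hrate := hG.mass_mul_le_gasRate hvmin hδ hη hK hi σ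
  have hmass := mul_nonneg (hG.ofSide_pos σ).le (binMass_nonneg (hG.ofSide_cutoff σ) hδ i)
  have hle : ofSide nL nR σ * binMass (ofSide fL fR σ) vmin δ i
      * (binEdge vmin δ (i + 1) * (t + τ - t) + (σ * p - η * τ / 2 - (σ * p + η * τ / 2)))
        ≤ gasRate nL nR vmax η * τ := by
    nlinarith [mul_le_mul_of_nonneg_right hrate hτ, mul_nonneg hmass (mul_nonneg hη hτ)]
  have hgasRate : 0 ≤ gasRate nL nR vmax η :=
    (mul_nonneg hmass (add_nonneg (hvmin.le.trans (le_binEdge hδ (i + 1))) hη)).trans hrate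
  convert h.measure_not_countGE_sub_le (a := η * τ) (measurableSet_crossing ..) (by positivity)
    hmean (hmean'.trans (ENNReal.ofReal_le_ofReal hle)) hs hs1 ?_ using 3
  · rw [lowerCount, binMass]; ring_nf
  · linarith [mul_le_mul_of_nonneg_right hsη hτ]

theorem countsBetween_of_mem_cell {A : Set (ℝ × ℝ)} {up lo : ℕ → ℝ} {d t₁ x : ℝ} (hσ : |σ| = 1)
    (hx : |x - p| ≤ d)
    (hcount : ∀ i ∈ Finset.range K,
      CountLE A (crossing σ (σ * p - d) (σ * p + d) t t₁ (binEdge vmin δ i)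
        (binEdge vmin δ (i + 1))) (up i) ∧
      CountGE A (crossing σ (σ * p + d) (σ * p - d) t t₁ (binEdge vmin δ i)
        (binEdge vmin δ (i + 1))) (lo i)) :
    CountsBetween A vmin δ t t₁ K up lo σ (σ * x) := by
  have hσx : |σ * x - σ * p| ≤ d := by rwa [← mul_sub, abs_mul, hσ, one_mul]
  obtain ⟨hlo, hhi⟩ := abs_le.mp hσx
  intro i hi
  obtain ⟨hle, hge⟩ := hcount i (Finset.mem_range.mpr hi)
  exact ⟨hle.mono (crossing_subset (by linarith) (by linarith)),
    hge.mono (crossing_subset (by linarith) (by linarith))⟩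

theorem IsPoissonProcess.measure_not_countsBetween_le
    (h : IsPoissonProcess μ (gasIntensity nL nR fL fR) S) (hG : IsGas vmin vmax nL nR fL fR)
    (hvmin : 0 < vmin) (hδ : 0 ≤ δ) (hη : 0 ≤ η) (hτ : 0 ≤ τ) (hK : binEdge vmin δ K = vmax)
    (hs : 0 ≤ s) (hs1 : s ≤ 1) (hsη : 2 * (gasRate nL nR vmax η * s) ≤ η) (hσ : |σ| = 1)
    (ht : 0 ≤ t) (hp : |p| ≤ vmin * t + η * τ / 2) :
    μ {ω | ¬ ∀ x, |x - p| ≤ η * τ / 2 → CountsBetween (S ω) vmin δ t (t + τ) K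
        (upperCount (ofSide nL nR σ) (ofSide fL fR σ) vmin δ η τ)
        (lowerCount (ofSide nL nR σ) (ofSide fL fR σ) vmin δ η τ) σ (σ * x)}
      ≤ K * (2 * ENNReal.ofReal (Real.exp (-(s * (η * τ) / 2)))) := by
  refine (measure_not_le_of_imp fun ω hcount x hx =>
    countsBetween_of_mem_cell hσ hx hcount).trans ?_
  refine (measure_not_forall_mem_le fun i hi => ?_).trans_eq (by rw [Finset.card_range])
  have hi := Finset.mem_range.mp hi
  rw [two_mul]
  exact (measure_not_and_le _ _).trans (add_le_add
    (h.measure_not_countLE_crossing_le hG hvmin hδ hη hτ hK hs hs1 hsη hσ hi)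
    (h.measure_not_countGE_crossing_le hG hvmin hδ hη hτ hK hs hs1 hsη hσ hi ht hp))

theorem IsPoissonProcess.measure_not_countLE_nearby_le
    (h : IsPoissonProcess μ (gasIntensity nL nR fL fR) S) (hG : IsGas vmin vmax nL nR fL fR)
    (hvmax : 0 ≤ vmax) (hη : 0 ≤ η) (hτ : 0 ≤ τ) (hs : 0 ≤ s) (hs1 : s ≤ 1)
    (hsη : 2 * (gasRate nL nR vmax η * s) ≤ η) (p t : ℝ) :
    μ {ω | ¬ CountLE (S ω) (nearby p (2 * vmax * τ + η * τ / 2) t)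
        ((gasRate nL nR vmax η + η) * τ)}
      ≤ ENNReal.ofReal (Real.exp (-(s * (η * τ) / 2))) := by
  have hrate : 0 ≤ gasRate nL nR vmax η :=
    mul_nonneg (add_pos hG.left_pos hG.right_pos).le (by positivity)
  rw [add_mul]
  refine h.measure_not_countLE_add_le (measurableSet_nearby ..) (by positivity)
    ((hG.intensity_nearby_le ..).trans_eq ?_) hs hs1 ?_
  · rw [gasRate]; ring_nf
  · linarith [mul_le_mul_of_nonneg_right hsη hτ]

theorem IsPoissonProcess.measure_not_typicalAt_cell_le
    (h : IsPoissonProcess μ (gasIntensity nL nR fL fR) S) (hG : IsGas vmin vmax nL nR fL fR)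
    (hvmin : 0 < vmin) (hδ : 0 ≤ δ) (hη : 0 ≤ η) (hτ : 0 ≤ τ) (hK : binEdge vmin δ K = vmax)
    (hs : 0 ≤ s) (hs1 : s ≤ 1) (hsη : 2 * (gasRate nL nR vmax η * s) ≤ η)
    (ht : 0 ≤ t) (hp : |p| ≤ vmin * t + η * τ / 2) :
    μ {ω | ¬ ∀ x, |x - p| ≤ η * τ / 2 →
        TypicalAt nL nR fL fR vmin vmax δ η τ K (S ω) t x}
      ≤ (1 + 4 * K) * ENNReal.ofReal (Real.exp (-(s * (η * τ) / 2))) := by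
  have hvmax : 0 ≤ vmax := hK ▸ hvmin.le.trans (le_binEdge hδ K)
  have hside := fun σ (hσ : |σ| = 1) =>
    h.measure_not_countsBetween_le hG hvmin hδ hη hτ hK hs hs1 hsη hσ ht hp
  refine (measure_not_le_of_imp fun ω hcount x hx => ?_).trans
    (((measure_not_and_le _ _).trans (add_le_add
      (h.measure_not_countLE_nearby_le hG hvmax hη hτ hs hs1 hsη p t)
      ((measure_not_and_le _ _).trans
        (add_le_add (hside 1 abs_one) (hside (-1) (by simp)))))).trans_eq (by ring))
  obtain ⟨hnear, hright, hleft⟩ := hcount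
  refine ⟨hnear.mono fun a (ha : |a.1 + a.2 * t - x| ≤ _) => ?_, fun σ hσ => ?_⟩
  · calc |a.1 + a.2 * t - p| ≤ |a.1 + a.2 * t - x| + |x - p| := abs_sub_le ..
      _ ≤ 2 * vmax * τ + η * τ / 2 := add_le_add ha hx
  · rcases eq_or_eq_neg_of_abs_eq hσ with rfl | rfl
    exacts [hright x hx, hleft x hx]

theorem exists_int_mem_Icc_abs_sub_mul_le {d r x : ℝ} (hd : 0 < d) (hx : |x| ≤ r) :
    ∃ j ∈ Finset.Icc (-(⌊r / d + 1 / 2⌋₊ : ℤ)) ⌊r / d + 1 / 2⌋₊, |x - j * d| ≤ d / 2 := by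
  have hround := abs_sub_round (x / d)
  refine ⟨round (x / d), Finset.mem_Icc.mpr (abs_le.mp ?_), ?_⟩
  · have hnat : ((round (x / d)).natAbs : ℝ) ≤ r / d + 1 / 2 := by
      rw [Nat.cast_natAbs, Int.cast_abs]
      calc |(round (x / d) : ℝ)| ≤ |x / d| + |x / d - round (x / d)| := by
            linarith [abs_sub_abs_le_abs_sub (round (x / d) : ℝ) (x / d),
              abs_sub_comm (x / d) (round (x / d))]
        _ ≤ r / d + 1 / 2 := by rw [abs_div, abs_of_pos hd]; gcongr
    rw [Int.abs_eq_natAbs]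
    exact_mod_cast Nat.le_floor hnat
  · calc |x - round (x / d) * d| = |x / d - round (x / d)| * d := by
          rw [← abs_of_pos hd, ← abs_mul, abs_of_pos hd, sub_mul, div_mul_cancel₀ _ hd.ne']
      _ ≤ 1 / 2 * d := by gcongr
      _ = d / 2 := by ring

theorem IsPoissonProcess.measure_not_typicalAt_le
    (h : IsPoissonProcess μ (gasIntensity nL nR fL fR) S) (hG : IsGas vmin vmax nL nR fL fR)
    (hvmin : 0 < vmin) (hδ : 0 ≤ δ) (hη : 0 < η) (hτ : 0 < τ) (hK : binEdge vmin δ K = vmax)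
    (hs : 0 ≤ s) (hs1 : s ≤ 1) (hsη : 2 * (gasRate nL nR vmax η * s) ≤ η) {r : ℝ} (hr : 0 ≤ r)
    (ht : 0 ≤ t) (hrt : r ≤ vmin * t) :
    μ {ω | ¬ ∀ x, |x| ≤ r → TypicalAt nL nR fL fR vmin vmax δ η τ K (S ω) t x}
      ≤ ENNReal.ofReal ((2 * (r / (η * τ)) + 2) *
        ((1 + 4 * K) * Real.exp (-(s * (η * τ) / 2)))) := by
  have hd : 0 < η * τ := mul_pos hη hτ
  set J := ⌊r / (η * τ) + 1 / 2⌋₊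
  have hJ : (J : ℝ) ≤ r / (η * τ) + 1 / 2 := Nat.floor_le (by positivity)
  have hcell : ∀ j ∈ Finset.Icc (-(J : ℤ)) J, |j * (η * τ)| ≤ vmin * t + η * τ / 2 := by
    intro j hj
    have hjJ : |(j : ℝ)| ≤ J := by exact_mod_cast abs_le.mpr (Finset.mem_Icc.mp hj)
    calc |j * (η * τ)| = |(j : ℝ)| * (η * τ) := by rw [abs_mul, abs_of_pos hd]
      _ ≤ (r / (η * τ) + 1 / 2) * (η * τ) := by gcongr; exact hjJ.trans hJ
      _ = r + η * τ / 2 := by field_simp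
      _ ≤ vmin * t + η * τ / 2 := by gcongr
  calc _ ≤ μ {ω | ¬ ∀ j ∈ Finset.Icc (-(J : ℤ)) J, ∀ x, |x - j * (η * τ)| ≤ η * τ / 2 →
          TypicalAt nL nR fL fR vmin vmax δ η τ K (S ω) t x} :=
        measure_not_le_of_imp fun ω htyp x hx =>
          have ⟨j, hj, hxj⟩ := exists_int_mem_Icc_abs_sub_mul_le hd hx
          htyp j hj x hxj
    _ ≤ (Finset.Icc (-(J : ℤ)) J).card *
          ((1 + 4 * K) * ENNReal.ofReal (Real.exp (-(s * (η * τ) / 2)))) :=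
        measure_not_forall_mem_le fun j hj =>
          h.measure_not_typicalAt_cell_le hG hvmin hδ hη.le hτ.le hK hs hs1 hsη ht (hcell j hj)
    _ = ENNReal.ofReal ((2 * J + 1) * ((1 + 4 * K) * Real.exp (-(s * (η * τ) / 2)))) := by
        have hcard : (Finset.Icc (-(J : ℤ)) J).card = 2 * J + 1 := by rw [Int.card_Icc]; omega
        rw [hcard, ENNReal.ofReal_mul (by positivity), ENNReal.ofReal_mul (by positivity)]
        congr 2 <;> norm_cast
    _ ≤ _ := by
        refine ENNReal.ofReal_le_ofReal (mul_le_mul_of_nonneg_right ?_ (by positivity))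
        linarith

theorem IsPoissonProcess.measure_exists_not_typicalAt_le
    (h : IsPoissonProcess μ (gasIntensity nL nR fL fR) S) (hG : IsGas vmin vmax nL nR fL fR)
    (hvmin : 0 < vmin) (hδ : 0 ≤ δ) (hη : 0 < η) (hτ : 0 < τ) (hK : binEdge vmin δ K = vmax)
    (hs : 0 ≤ s) (hs1 : s ≤ 1) (hsη : 2 * (gasRate nL nR vmax η * s) ≤ η) {b : ℝ} (hb : 0 ≤ b)
    (hbv : b ≤ vmin) (n : ℕ) :
    μ {ω | ¬ ∀ k ∈ Finset.range n, ∀ x, |x| ≤ b * (k * τ) →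
        TypicalAt nL nR fL fR vmin vmax δ η τ K (S ω) (k * τ) x}
      ≤ ENNReal.ofReal (n * ((2 * (b * n / η) + 2) *
        ((1 + 4 * K) * Real.exp (-(s * (η * τ) / 2))))) := by
  set q := (1 + 4 * K) * Real.exp (-(s * (η * τ) / 2))
  calc _ ≤ (Finset.range n).card * ENNReal.ofReal ((2 * (b * n / η) + 2) * q) :=
        measure_not_forall_mem_le fun k hk => ?_
    _ = _ := by
        rw [Finset.card_range, ENNReal.ofReal_mul (Nat.cast_nonneg n), ENNReal.ofReal_natCast]
  refine (h.measure_not_typicalAt_le hG hvmin hδ hη hτ hK hs hs1 hsη (by positivity)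
    (by positivity) (by gcongr)).trans
      (ENNReal.ofReal_le_ofReal (mul_le_mul_of_nonneg_right ?_ (by positivity)))
  have hkn : (k : ℝ) ≤ n := by exact_mod_cast (Finset.mem_range.mp hk).le
  rw [← mul_assoc, mul_div_mul_right _ _ hτ.ne']
  gcongr

end Improbable

/-! ### The velocities coincide with high probability -/

section HighProbability

variable {m M b V₀ vmin vmax nL nR δ η T : ℝ} {fL fR : ℝ → ℝ} {Ω : Type*} [MeasurableSpace Ω]
  {μ : Measure Ω} {S : Ω → Set (ℝ × ℝ)}

theorem exists_measurableSet_of_measure_not_le [IsProbabilityMeasure μ] {P : Ω → Prop} {q : ℝ}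
    (hq : 0 ≤ q) (h : μ {ω | ¬ P ω} ≤ ENNReal.ofReal q) :
    ∃ G : Set Ω, MeasurableSet G ∧ (∀ ω ∈ G, P ω) ∧ 1 - q ≤ μ.real G := by
  have hmeas := measurableSet_toMeasurable μ {ω | ¬ P ω}
  refine ⟨(toMeasurable μ {ω | ¬ P ω})ᶜ, hmeas.compl, fun ω hω => ?_, ?_⟩
  · by_contra hP
    exact hω (subset_toMeasurable _ _ hP)
  · rw [probReal_compl_eq_one_sub hmeas, measureReal_def, measure_toMeasurable]
    exact sub_le_sub_left (ENNReal.toReal_le_of_le_ofReal hq h) 1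

theorem PressureBalance.ofSide_neg_eq (h : PressureBalance nL nR fL fR) {σ : ℝ} (hσ : |σ| = 1) :
    ofSide nL nR (-σ) * ∫ v in Ioi (0 : ℝ), v ^ 2 * ofSide fL fR (-σ) v
      = ofSide nL nR σ * ∫ v in Ioi (0 : ℝ), v ^ 2 * ofSide fL fR σ v := by
  have hneg : ¬ (0 : ℝ) < -1 := by norm_num
  rcases eq_or_eq_neg_of_abs_eq hσ with rfl | rfl
  · simp only [ofSide, one_pos, hneg, if_true, if_false]
    exact h
  · simp only [ofSide, one_pos, hneg, neg_neg, if_true, if_false]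
    exact h.symm

theorem IsPoissonProcess.measure_not_coincide_le_of_nearby
    (h : IsPoissonProcess μ (gasIntensity nL nR fL fR) S) (hG : IsGas vmin vmax nL nR fL fR)
    (hvmax : 0 ≤ vmax) (hR : SlowRegime m M b vmin) (hV : |V₀| ≤ b / 2) (hT : 0 < T)
    (hT1 : T ≤ 1) {N : ℕ} (hN : 2 ≤ N) (hkick : kick m M * (2 * vmax) * N ≤ b / 2) :
    μ {ω | ¬ VelocitiesCoincide m M b V₀ (S ω) T}
      ≤ ENNReal.ofReal (T ^ 2 * Real.exp ((nL + nR) * (4 * vmax) * Real.exp 1 - N)) := by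
  have hrate : 0 ≤ (nL + nR) * (4 * vmax) :=
    mul_nonneg (add_pos hG.left_pos hG.right_pos).le (by positivity)
  refine (measure_mono_ae ?_).trans
    (h.measure_not_countLE_le_sq (measurableSet_nearby 0 (2 * vmax * T) 0) hrate hT hT1
      ((hG.intensity_nearby_le ..).trans_eq (by ring_nf)) hN)
  filter_upwards [h.ae_regularGas hG m M V₀] with ω hreg hω hcount
  exact hω (velocitiesCoincide_of_few hR hreg hvmax hV hcount hkick)

theorem IsPoissonProcess.measure_not_coincide_le_of_windows
    (h : IsPoissonProcess μ (gasIntensity nL nR fL fR) S) (hG : IsGas vmin vmax nL nR fL fR)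
    (hbal : PressureBalance nL nR fL fR) (hR : SlowRegime m M b vmin) (hV : |V₀| ≤ b / 2)
    {K : ℕ} (hB : FineBins vmin vmax (b / 8) (min nL nR) δ η K) {s τ : ℝ} (hs : 0 ≤ s)
    (hs1 : s ≤ 1) (hsη : 2 * (gasRate nL nR vmax η * s) ≤ η) (hτ : 0 < τ)
    (hkick : kick m M * (2 * vmax) * ((gasRate nL nR vmax η + η) * τ) ≤ b / 8) {n : ℕ}
    (hT : T ≤ n * τ) :
    μ {ω | ¬ VelocitiesCoincide m M b V₀ (S ω) T}
      ≤ ENNReal.ofReal (n * ((2 * (b * n / η) + 2) *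
        ((1 + 4 * K) * Real.exp (-(s * (η * τ) / 2))))) := by
  have hδ := hB.width_pos
  have hb := hR.b_pos
  have hbv := hR.lt_vmin
  have hvmax : 0 ≤ vmax := hB.last_edge ▸ hR.vmin_pos.le.trans (le_binEdge hδ.le K)
  refine (measure_mono_ae ?_).trans (h.measure_exists_not_typicalAt_le hG hR.vmin_pos hδ.le
    hB.tol_pos hτ hB.last_edge hs hs1 hsη hb.le hbv.le n)
  filter_upwards [h.ae_regularGas hG m M V₀] with ω hreg hω htyp
  refine hω (velocitiesCoincide_of_typicalCounts hR hreg hvmax hV hτ hδ hB.last_edge hkick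
    (fun σ hσ => ?_) (fun k hk => htyp k (Finset.mem_range.mpr hk)) hT)
  have hmin : min nL nR ≤ ofSide nL nR (-σ) := by
    unfold ofSide; split_ifs <;> [exact min_le_right ..; exact min_le_left ..]
  exact sum_upperCount_le_sum_lowerCount (hG.ofSide_cutoff _) (hG.ofSide_cutoff _) hR.vmin_pos
    (by positivity) (by linarith) hτ.le (hG.ofSide_pos _).le (hG.ofSide_pos _).le
    (hbal.ofSide_neg_eq hσ) (hB.mono hmin (by positivity) hR.vmin_pos.le)

theorem IsPoissonProcess.measure_not_coincide_le_of_le_one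
    (h : IsPoissonProcess μ (gasIntensity nL nR fL fR) S) (hG : IsGas vmin vmax nL nR fL fR)
    (hvmax : 0 < vmax) (hR : SlowRegime m M b vmin) (hV : |V₀| ≤ b / 2) (hT : 0 < T)
    (hT1 : T ≤ 1) (hε : m / M ≤ b / (16 * vmax)) :
    μ {ω | ¬ VelocitiesCoincide m M b V₀ (S ω) T}
      ≤ ENNReal.ofReal (T ^ 2 * (Real.exp ((nL + nR) * (4 * vmax) * Real.exp 1 + 1)
        * Real.exp (-(b / (8 * vmax)) / (m / M)))) := by
  have hε0 : 0 < m / M := div_pos hR.m_pos hR.M_pos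
  have hkick_le := kick_le hR.m_pos hR.M_pos
  generalize m / M = ε at *
  have hb := hR.b_pos
  set x := b / (8 * vmax) / ε with hx
  have hx2 : 2 ≤ x := by
    rw [hx, le_div_iff₀ hε0]
    calc 2 * ε ≤ 2 * (b / (16 * vmax)) := by gcongr
      _ = b / (8 * vmax) := by field_simp; norm_num
  refine (h.measure_not_coincide_le_of_nearby hG hvmax.le hR hV hT hT1 (N := ⌊x⌋₊)
    (Nat.le_floor hx2) ?_).trans (ENNReal.ofReal_le_ofReal ?_)
  · calc kick m M * (2 * vmax) * ⌊x⌋₊ ≤ 2 * ε * (2 * vmax) * x := by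
          gcongr
          exact Nat.floor_le (by positivity)
      _ = b / 2 := by rw [hx]; field_simp; norm_num
  · rw [← Real.exp_add, neg_div, ← hx]
    gcongr
    linarith [Nat.lt_floor_add_one x]

theorem IsPoissonProcess.measure_not_coincide_le_of_one_le
    (h : IsPoissonProcess μ (gasIntensity nL nR fL fR) S) (hG : IsGas vmin vmax nL nR fL fR)
    (hbal : PressureBalance nL nR fL fR) (hR : SlowRegime m M b vmin) (hV : |V₀| ≤ b / 2)
    {K : ℕ} (hB : FineBins vmin vmax (b / 8) (min nL nR) δ η K) {s κ : ℝ} (hs : 0 ≤ s)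
    (hs1 : s ≤ 1) (hsη : 2 * (gasRate nL nR vmax η * s) ≤ η) (hκ : 0 < κ)
    (hkick : 2 * (2 * vmax) * ((gasRate nL nR vmax η + η) * κ) ≤ b / 8) (hT : 1 ≤ T)
    (hε : m / M ≤ κ) :
    μ {ω | ¬ VelocitiesCoincide m M b V₀ (S ω) T}
      ≤ ENNReal.ofReal (T ^ 2 * ((8 * b / η + 4) * (1 + 4 * K)
        * Real.exp (-(s * (η * κ) / 2) / (m / M)))) := by
  have hε0 : 0 < m / M := div_pos hR.m_pos hR.M_pos
  have hkick_le := kick_le hR.m_pos hR.M_pos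
  generalize m / M = ε at *
  have hb := hR.b_pos
  have hη := hB.tol_pos
  have hτ : 0 < κ / ε := div_pos hκ hε0
  set n := ⌈T / (κ / ε)⌉₊
  have hn : T ≤ n * (κ / ε) := (div_le_iff₀ hτ).mp (Nat.le_ceil _)
  have hnT : (n : ℝ) ≤ 2 * T := by
    have hle : T / (κ / ε) ≤ T := div_le_self (by linarith) ((one_le_div hε0).mpr hε)
    have hceil : (n : ℝ) < T / (κ / ε) + 1 := Nat.ceil_lt_add_one (by positivity)
    linarith
  have hvmax : 0 ≤ vmax := hB.last_edge ▸ hR.vmin_pos.le.trans (le_binEdge hB.width_pos.le K)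
  have hrate : 0 ≤ gasRate nL nR vmax η :=
    mul_nonneg (add_pos hG.left_pos hG.right_pos).le (by positivity)
  refine (h.measure_not_coincide_le_of_windows hG hbal hR hV hB hs hs1 hsη hτ ?_ hn).trans
    (ENNReal.ofReal_le_ofReal ?_)
  · calc _ ≤ 2 * ε * (2 * vmax) * ((gasRate nL nR vmax η + η) * (κ / ε)) := by
          gcongr
      _ = 2 * (2 * vmax) * ((gasRate nL nR vmax η + η) * κ) := by field_simp
      _ ≤ b / 8 := hkick
  · have hexp : -(s * (η * κ) / 2) / ε = -(s * (η * (κ / ε)) / 2) := by ring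
    rw [hexp]
    set q := (1 + 4 * K) * Real.exp (-(s * (η * (κ / ε)) / 2))
    calc n * ((2 * (b * n / η) + 2) * q)
        ≤ 2 * T * ((2 * (b * (2 * T) / η) + 2 * T) * q) := by
          gcongr
          linarith
      _ = _ := by ring

theorem IsGas.exists_bound_of_one_le (hG : IsGas vmin vmax nL nR fL fR)
    (hbal : PressureBalance nL nR fL fR) (hvmin : 0 < vmin) (hv : vmin < vmax) (hb : 0 < b) :
    ∃ C c κ : ℝ, 0 < C ∧ 0 < c ∧ 0 < κ ∧
      ∀ m M : ℝ, SlowRegime m M b vmin → m / M ≤ κ → ∀ V₀ : ℝ, |V₀| ≤ b / 2 →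
      ∀ (Ω : Type*) [MeasurableSpace Ω] (μ : Measure Ω) (S : Ω → Set (ℝ × ℝ)),
        IsPoissonProcess μ (gasIntensity nL nR fL fR) S → ∀ T : ℝ, 1 ≤ T →
          μ {ω | ¬ VelocitiesCoincide m M b V₀ (S ω) T}
            ≤ ENNReal.ofReal (T ^ 2 * (C * Real.exp (-c / (m / M)))) := by
  have hvmax := hvmin.trans hv
  obtain ⟨δ, η, K, hB⟩ := exists_fineBins hvmin hv (by positivity : 0 < b / 8)
    (lt_min hG.left_pos hG.right_pos)
  have hη := hB.tol_pos
  have hrate : 0 < gasRate nL nR vmax η :=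
    mul_pos (add_pos hG.left_pos hG.right_pos) (by positivity)
  have hs : 0 < min 1 (η / (2 * gasRate nL nR vmax η)) := by positivity
  have hκ : 0 < b / (32 * vmax * (gasRate nL nR vmax η + η)) := by positivity
  refine ⟨_, _, _, ?_, ?_, hκ, fun m M hR hε V₀ hV Ω _ μ S h T hT =>
    h.measure_not_coincide_le_of_one_le hG hbal hR hV hB hs.le (min_le_left ..) ?_ hκ ?_ hT hε⟩
  · positivity
  · positivity
  · calc _ ≤ 2 * (gasRate nL nR vmax η * (η / (2 * gasRate nL nR vmax η))) := by
          gcongr; exact min_le_right ..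
      _ = η := by field_simp
  · refine le_of_eq ?_
    field_simp
    norm_num

end HighProbability

theorem exists_mul_exp_neg_div_le_rpow_log_log (C : ℝ) {c : ℝ} (hc : 0 < c) :
    ∃ ε₀ : ℝ, 0 < ε₀ ∧ ∀ ε : ℝ, 0 < ε → ε < ε₀ →
      C * Real.exp (-c / ε) ≤ ε ^ Real.log (Real.log ε⁻¹) := by
  have hsq := (Real.isLittleO_pow_log_id_atTop (n := 2)).bound (half_pos hc)
  have hexp := (Real.tendsto_exp_atTop.comp
    (Filter.tendsto_id.const_mul_atTop (half_pos hc))).eventually_ge_atTop C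
  obtain ⟨y₀, hy₀⟩ := Filter.eventually_atTop.mp
    (hsq.and (hexp.and (Filter.eventually_gt_atTop 1)))
  refine ⟨(max y₀ 1)⁻¹, by positivity, fun ε hε hlt => ?_⟩
  obtain ⟨hsq, hC, hone⟩ := hy₀ ε⁻¹
    ((le_max_left ..).trans ((le_inv_comm₀ (by positivity) hε).mpr hlt.le))
  have hlog : 0 < Real.log ε⁻¹ := Real.log_pos hone
  have hsq : Real.log ε⁻¹ ^ 2 ≤ c / 2 * ε⁻¹ := by
    simpa [abs_of_pos hε] using hsq
  have hloglog : Real.log (Real.log ε⁻¹) ≤ Real.log ε⁻¹ := Real.log_le_self hlog.le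
  calc C * Real.exp (-c / ε) ≤ Real.exp (c / 2 * ε⁻¹) * Real.exp (-c / ε) := by gcongr; exact hC
    _ = Real.exp (-(c / 2 * ε⁻¹)) := by rw [← Real.exp_add]; ring_nf
    _ ≤ Real.exp (-(Real.log ε⁻¹ * Real.log (Real.log ε⁻¹))) := by
        refine Real.exp_le_exp.mpr (neg_le_neg (le_trans ?_ hsq))
        rw [sq]
        gcongr
    _ = ε ^ Real.log (Real.log ε⁻¹) := by
        rw [Real.rpow_def_of_pos hε, ← neg_mul, Real.log_inv, neg_neg]

end Piston

theorem mainTheorem5_general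
    (vmin vmax : ℝ) (hvmin : 0 < vmin) (hvmax : vmin < vmax)
    (nL nR : ℝ) (hnL : 0 < nL) (hnR : 0 < nR)
    (fL fR : ℝ → ℝ)
    (hfL : Piston.IsCutoffDensity vmin vmax fL) (hfR : Piston.IsCutoffDensity vmin vmax fR)
    (hbal : Piston.PressureBalance nL nR fL fR) (b : ℝ) (hb : 0 < b) :
    ∃ C c ε₀ : ℝ, 0 < C ∧ 0 < c ∧ 0 < ε₀ ∧
      ∀ m M : ℝ, 0 < m → 0 < M → m / M < ε₀ → b < Piston.maxSpeed m M vmin →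
      ∀ V₀ : ℝ, |V₀| ≤ b / 2 →
      ∀ (Ω : Type*) [MeasurableSpace Ω] (μ : Measure Ω) [IsProbabilityMeasure μ]
        (S : Ω → Set (ℝ × ℝ)),
        Piston.IsPoissonProcess μ (Piston.gasIntensity nL nR fL fR) S →
      ∀ T : ℝ, 0 < T →
        ∃ G : Set Ω, MeasurableSet G ∧
          (∀ ω ∈ G, Piston.VelocitiesCoincide m M b V₀ (S ω) T) ∧
          1 - T ^ 2 * (C * Real.exp (-c / (m / M))) ≤ μ.real G := by
  have hG : Piston.IsGas vmin vmax nL nR fL fR := ⟨hnL, hnR, hfL, hfR⟩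
  have hvmax₀ := hvmin.trans hvmax
  obtain ⟨C, c, κ, hC, hc, hκ, hlong⟩ := hG.exists_bound_of_one_le hbal hvmin hvmax hb
  refine ⟨max C (Real.exp ((nL + nR) * (4 * vmax) * Real.exp 1 + 1)), min c (b / (8 * vmax)),
    min κ (b / (16 * vmax)), by positivity, by positivity, by positivity, ?_⟩
  intro m M hm hM hε hslow V₀ hV Ω _ μ _ S h T hT
  have hR : Piston.SlowRegime m M b vmin := ⟨hm, hM, hb, hvmin, hslow⟩
  obtain ⟨hεκ, hεb⟩ := lt_min_iff.mp hε
  refine Piston.exists_measurableSet_of_measure_not_le (by positivity) ?_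
  rcases le_total T 1 with hT1 | hT1
  · refine (h.measure_not_coincide_le_of_le_one hG hvmax₀ hR hV hT hT1 hεb.le).trans ?_
    gcongr
    · exact le_max_right ..
    · exact min_le_right ..
  · refine (hlong m M hR hεκ.le V₀ hV Ω μ S h T hT1).trans ?_
    gcongr
    · exact le_max_left ..
    · exact min_le_left ..

theorem mainTheorem5
    (vmin vmax : ℝ) (hvmin : 0 < vmin) (hvmax : vmin < vmax)
    (nL nR : ℝ) (hnL : 0 < nL) (hnR : 0 < nR)
    (fL fR : ℝ → ℝ)
    (hfL : Piston.IsCutoffDensity vmin vmax fL) (hfR : Piston.IsCutoffDensity vmin vmax fR)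
    (hbal : Piston.PressureBalance nL nR fL fR) :
    ∃ d : ℝ, 0 < d ∧
      ∀ b : ℝ, 0 < b →
      ∃ ε₀ : ℝ, 0 < ε₀ ∧
        ∀ m M : ℝ, 0 < m → 0 < M → m / M < ε₀ → b < Piston.maxSpeed m M vmin →
        ∀ V₀ : ℝ, |V₀| < Real.sqrt (m / M) →
        ∀ (Ω : Type*) [MeasurableSpace Ω] (μ : Measure Ω) [IsProbabilityMeasure μ]
          (S : Ω → Set (ℝ × ℝ)),
          Piston.IsPoissonProcess μ (Piston.gasIntensity nL nR fL fR) S →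
        ∀ T : ℝ, 0 < T →
          ∃ G : Set Ω, MeasurableSet G ∧
            (∀ ω ∈ G, Piston.VelocitiesCoincide m M b V₀ (S ω) T) ∧
            1 - T ^ 2 * (m / M) ^ (d * Real.log (Real.log (m / M)⁻¹)) ≤ μ.real G := by
  refine ⟨1, one_pos, fun b hb => ?_⟩
  obtain ⟨C, c, ε₁, -, hc, hε₁, hcoincide⟩ :=
    mainTheorem5_general vmin vmax hvmin hvmax nL nR hnL hnR fL fR hfL hfR hbal b hb
  obtain ⟨ε₂, hε₂, hbound⟩ := Piston.exists_mul_exp_neg_div_le_rpow_log_log C hc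
  refine ⟨min (min ε₁ ε₂) ((b / 2) ^ 2), by positivity, ?_⟩
  intro m M hm hM hε hslow V₀ hV Ω _ μ _ S h T hT
  obtain ⟨hε, hεb⟩ := lt_min_iff.mp hε
  obtain ⟨hε₁, hε₂⟩ := lt_min_iff.mp hε
  obtain ⟨G, hG, hGcoincide, hμG⟩ := hcoincide m M hm hM hε₁ hslow V₀
    (hV.le.trans (Real.sqrt_le_iff.mpr ⟨by positivity, hεb.le⟩)) Ω μ S h T hT
  refine ⟨G, hG, hGcoincide, le_trans ?_ hμG⟩
  rw [one_mul]
  gcongr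
  exact hbound (m / M) (by positivity) hε₂
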